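/- Let $H\in(1/2,1)$ and let $Y=\{Y(t)\}_{t\in\mathbb Z}$ be a real second-order stationary process with spectral density $h$ in normalised frequency, i.e. $\mathrm{Cov}(Y(s),Y(t))=\int_{-1/2}^{1/2}h(x)e^{2\pi i(t-s)x}\,dx$, where $h$ is positive and continuous on $[-1/2,1/2]$ and three times continuously differentiable on $(-1/2,1/2)$. Let $X=(1-B)^{-(H-1/2)}Y$ be the associated fractionally differenced process, i.e. $X(t)=\sum_{j\ge0}\frac{\Gamma(j+H-1/2)}{\Gamma(H-1/2)\,\Gamma(j+1)}\,Y(t-j)$ in mean square. Let $\gamma$ be the autocovariance function of $X$, $\omega_H(n)=\sum_{k=0}^{n-1}\sum_{i=-k}^{k}\gamma(i)$ its variance time function and $\varphi_H(n)=\omega_H(n)/\omega_H(1)$ its correlation time function; let $\varphi_H^{(m)}$ be the correlation time function of the aggregated process $X^{(m)}(t)=\frac1m\sum_{j=m(t-1)+1}^{mt}X(j)$. Put $c_f=(2\pi)^{1-2H}h(0)$, $C(H)=\pi^{-1}H\,\Gamma(2H)\sin(\pi H)$, $\mathcal V=c_f/\big((2\pi)^{2-2H}C(H)\big)$, and $$f_H(x)=h(x)\,|2\sin\pi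 x|^{-(2H-1)},\qquad f_H^*(x)=c_f\,\pi^{-2}(2\pi)^{2H+1}\sin^2(\pi x)\sum_{j\in\mathbb Z}|2\pi j+2\pi x|^{-(2H+1)},$$ $$g=f_H/f_H^*\ \ (g(0)=1),\qquad G_j=\int_{-1/2}^{1/2}g(x)\cos(2\pi jx)\,dx .$$ Here $f_H^*$ is the spectral density of the fractional Gaussian noise with variance $\mathcal V$, whose variance time function is $\mathcal V n^{2H}$ and whose correlation time function is $n^{2H}$. Then there is a real constant $D$ such that: 1. for every integer $n\ge1$, as $m\to\infty$, $$\varphi_H^{(m)}(n)=n^{2H}+D\,(1-n^{2H})\,m^{-2H}+o(m^{-2H})=n^{2H}+O(m^{-2H});$$ 2. $\omega_H(n)=\mathcal V n^{2H}+\mathcal V D+o(1)$ as $n\to\infty$ (so $D$ is the additive constant between the variance time functions of $X$ and of its fGn limit, relative to $\mathcal V$); 3. $D=-2\sum_{j=1}^\infty j^{2H}G_j$ whenever $\sum_{j\ge1} j^{2H}|G_j|<\infty$, and this sum is finite whenever the $1$-periodic extension of $h$ from $[-1/2,1/2]$ is three times continuously differentiable on $\mathbb R$. -/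

import Mathlib

open MeasureTheory ProbabilityTheory Filter Topology Asymptotics

noncomputable section

namespace FracDiff

/-! ### Second-order structure of a discrete time process -/

/-- A real discrete time process `Y` is second-order stationary: square integrable, with constant
mean, constant positive variance, and autocovariances that depend only on the lag. -/
structure IsSecondOrderStationary {Ω : Type*} [MeasurableSpace Ω] (μ : Measure Ω)
    (Y : ℤ → Ω → ℝ) : Prop where
  memLp : ∀ t, MemLp (Y t) 2 μ
  mean_eq : ∀ s t, ∫ w, Y s w ∂μ = ∫ w, Y t w ∂μ
  variance_pos : ∀ t, 0 < variance (Y t) μ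
  covariance_eq : ∀ s t k, covariance (Y s) (Y (s + k)) μ = covariance (Y t) (Y (t + k)) μ

/-- Autocovariance function `γ(k) = E[(X(0) - E X(0)) (X(k) - E X(k))]`. -/
def acvf {Ω : Type*} [MeasurableSpace Ω] (μ : Measure Ω) (X : ℤ → Ω → ℝ) (k : ℤ) : ℝ :=
  covariance (X 0) (X k) μ

/-- The double integration operator on sequences,
`(I a)(n) = ∑_{k=0}^{n-1} ∑_{i=-k}^{k} a(i)`. -/
def doubleSum (a : ℤ → ℝ) (n : ℕ) : ℝ :=
  ∑ k ∈ Finset.range n, ∑ i ∈ Finset.Icc (-(k : ℤ)) (k : ℤ), a i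

/-- Variance time function `ω = I γ`. -/
def vtf {Ω : Type*} [MeasurableSpace Ω] (μ : Measure Ω) (X : ℤ → Ω → ℝ) (n : ℕ) : ℝ :=
  doubleSum (acvf μ X) n

/-- Correlation time function `φ(n) = ω(n) / ω(1)`. -/
def ctf {Ω : Type*} [MeasurableSpace Ω] (μ : Measure Ω) (X : ℤ → Ω → ℝ) (n : ℕ) : ℝ :=
  vtf μ X n / vtf μ X 1

/-- Aggregation of level `m`: `X^{(m)}(t) = (1/m) ∑_{j=m(t-1)+1}^{mt} X(j)`. -/
def aggregate {Ω : Type*} (X : ℤ → Ω → ℝ) (m : ℕ) (t : ℤ) (w : Ω) : ℝ :=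
  (1 / (m : ℝ)) * ∑ j ∈ Finset.Icc ((m : ℤ) * (t - 1) + 1) ((m : ℤ) * t), X j w

/-- `h` is the spectral density of `Y`, in normalised frequency: `h` is nonnegative and integrable
on `[-1/2, 1/2]` and `Cov(Y(s), Y(t)) = ∫_{-1/2}^{1/2} h(x) e^{2πi(t-s)x} dx`.
For a real process this forces `h` to be even almost everywhere. -/
structure HasSpectralDensity {Ω : Type*} [MeasurableSpace Ω] (μ : Measure Ω)
    (Y : ℤ → Ω → ℝ) (h : ℝ → ℝ) : Prop where
  nonneg : ∀ x ∈ Set.Icc (-(1 / 2) : ℝ) (1 / 2), 0 ≤ h x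
  integrable : IntervalIntegrable h volume (-(1 / 2) : ℝ) (1 / 2)
  covariance_eq : ∀ s t : ℤ, ((covariance (Y s) (Y t) μ : ℝ) : ℂ) =
    ∫ x in (-(1 / 2) : ℝ)..(1 / 2),
      (h x : ℂ) * Complex.exp (2 * Real.pi * Complex.I * ((t : ℂ) - (s : ℂ)) * (x : ℂ))

/-! ### Fractional differencing -/

/-- Coefficient of `B^j` in `(1 - B)^δ`, for `δ` not a natural number. -/
def fracDiffCoeff (δ : ℝ) (j : ℕ) : ℝ :=
  Real.Gamma (j - δ) / (Real.Gamma (-δ) * Real.Gamma (j + 1))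

/-- `X = (1 - B)^δ Y`: each `X(t)` is the mean square limit of the partial sums of
`∑_{j ≥ 0} fracDiffCoeff δ j * Y(t - j)`. -/
structure IsFracDiff {Ω : Type*} [MeasurableSpace Ω] (μ : Measure Ω) (δ : ℝ)
    (Y X : ℤ → Ω → ℝ) : Prop where
  memLp : ∀ t, MemLp (X t) 2 μ
  tendsto : ∀ t, Tendsto
    (fun N : ℕ => eLpNorm
      (fun w => X t w - ∑ j ∈ Finset.range N, fracDiffCoeff δ j * Y (t - (j : ℤ)) w) 2 μ)
    atTop (𝓝 0)

/-- The spectral density `f_H(x) = h(x) |2 sin πx|^{-(2H-1)}`. -/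
def fracSpectralDensity (H : ℝ) (h : ℝ → ℝ) (x : ℝ) : ℝ :=
  h x * |2 * Real.sin (Real.pi * x)| ^ (-(2 * H - 1))

/-- The prefactor `c_f = (2π)^{1-2H} h(0)` of `f_H` at the origin. -/
def fracPrefactor (H : ℝ) (h : ℝ → ℝ) : ℝ :=
  (2 * Real.pi) ^ (1 - 2 * H) * h 0

/-! ### Fractional Gaussian noise -/

/-- `C(H) = π⁻¹ H Γ(2H) sin(πH)`. -/
def fgnConst (H : ℝ) : ℝ :=
  Real.pi⁻¹ * H * Real.Gamma (2 * H) * Real.sin (H * Real.pi)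

/-- The spectral density `f*_H` of the fGn whose prefactor at the origin is `c`. -/
def fgnSpectralDensity (H c x : ℝ) : ℝ :=
  c * (Real.pi ^ 2)⁻¹ * (2 * Real.pi) ^ (2 * H + 1) * Real.sin (Real.pi * x) ^ 2 *
    ∑' j : ℤ, |2 * Real.pi * (j : ℝ) + 2 * Real.pi * x| ^ (-(2 * H + 1))

/-- The variance `V` of the fGn whose prefactor at the origin is `c`, that is the solution of
`c = V (2π)^{2-2H} C(H)`. -/
def fgnVariance (H c : ℝ) : ℝ :=
  c / ((2 * Real.pi) ^ (2 - 2 * H) * fgnConst H)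

/-- The VTF `ω*_{H,V}(n) = V n^{2H}` of fGn. -/
def fgnVTF (H V : ℝ) (n : ℕ) : ℝ := V * (n : ℝ) ^ (2 * H)

/-- The CTF `φ*_H(n) = n^{2H}` of fGn. -/
def fgnCTF (H : ℝ) (n : ℕ) : ℝ := (n : ℝ) ^ (2 * H)

/-! ### The spectral ratio and its Fourier coefficients -/

/-- The ratio `g = f_H / f*_H`, for the fGn with the same prefactor at the origin (so that
`g(0) := lim_{x → 0} g(x) = 1`). -/
def spectralRatio (H : ℝ) (h : ℝ → ℝ) (x : ℝ) : ℝ :=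
  if x = 0 then 1 else
    fracSpectralDensity H h x / fgnSpectralDensity H (fracPrefactor H h) x

/-- The Fourier coefficients `G_j = ∫_{-1/2}^{1/2} g(x) e^{-2πijx} dx` of the even function `g`. -/
def ratioCoeff (H : ℝ) (h : ℝ → ℝ) (j : ℕ) : ℝ :=
  ∫ x in (-(1 / 2) : ℝ)..(1 / 2), spectralRatio H h x * Real.cos (2 * Real.pi * (j : ℝ) * x)

end FracDiff

end

/-! Everything is read off the variance of a sum of consecutive terms. If `X` has spectral density
`f`, the double sum of its covariances collapses by Fejér's identity to `ω(n) = ∫ f(x) sin²(πnx) /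
sin²(πx) dx`, and n blocks of length m make one block of length nm, so the aggregated correlation
time function is `ω(nm) / ω(m)` (`vtf_aggregate`, `ctf_aggregate`). That `X` has spectral density
`f_H` is `covariance_fracDiff`: mean square convergence on one side, dominated convergence of the
binomial series of `(1 - z)^{-d}` on the unit circle on the other.

With `K(x) = ∑_k |k + x|^{-(2H+1)}` one has `f_H / sin² = κ K g`, where `κ = c_f / π²`
(`fracSpectralDensity_eq_mul`). For `g = 1`, unfolding the periodisation and rescaling give exactly
`I n^{2H}` with `I = ∫ |x|^{-(2H+1)} sin²(πx) dx` over the line (`integral_powKernel_mul_sin_sq`),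
and `V = κ I`. In the remainder `κ ∫ K (g - 1) sin²(πnx)` the factor `g - 1` is `O(x²)`, so `K (g -
1)` is integrable because `H < 1`. Writing `sin² = (1 - cos) / 2` and applying the Riemann-Lebesgue
lemma, the remainder tends to `(κ/2) ∫ K (g - 1) = V D` (`tendsto_fejerIntegral_sub`). The expansion
under aggregation is then algebra (`aggregation_asymptotics`).

For the series, `g(x) - 1 = -4 ∑ G_j sin²(πjx)` is integrated against `K` term by term, each term
giving `I j^{2H}` (`additiveConst_eq_tsum`). If `h` extends periodically to a C³ function, the only
singularity of `g` comes from `|x|^{2H+1}` at the origin. Its third derivative is still integrable,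
and the odd derivative at each end of `[0, 1/2]` vanishes by symmetry, so three integrations by
parts give `G_j = O(j⁻³)` (`summable_ratioCoeff`). -/

namespace FracDiff

/-! ### The variance time function of fractional Gaussian noise -/

/-- Tonelli's theorem on the positive quadrant, for iterated Bochner integrals. -/
theorem integral_Ioi_swap {f : ℝ → ℝ → ℝ} (hm : Measurable (Function.uncurry f))
    (h0 : ∀ x > 0, ∀ y > 0, 0 ≤ f x y)
    (hG : ∀ y > 0, IntegrableOn (fun x => f x y) (Set.Ioi 0))
    (hGi : IntegrableOn (fun y => ∫ x in Set.Ioi 0, f x y) (Set.Ioi 0)) :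
    ∫ x in Set.Ioi 0, ∫ y in Set.Ioi 0, f x y = ∫ y in Set.Ioi 0, ∫ x in Set.Ioi 0, f x y := by
  refine integral_integral_swap ?_
  rw [integrable_prod_iff' hm.aestronglyMeasurable]
  refine ⟨(ae_restrict_iff' measurableSet_Ioi).2 (ae_of_all _ fun y hy => hG y hy), ?_⟩
  refine hGi.congr_fun (fun y hy => ?_) measurableSet_Ioi
  refine setIntegral_congr_fun measurableSet_Ioi fun x hx => ?_
  simp only [Function.uncurry]
  rw [Real.norm_of_nonneg (h0 x hx y hy)]

/-- Insert `1 / (1 + u²) = ∫ e^{-w(1+u²)} dw` and swap: the integral in `u` is of Gaussian type and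
gives `Γ(H) w^{-H} / 2`, that in `w` gives `Γ(1 - H)`, and the reflection formula finishes. -/
theorem integral_rpow_div_one_add_sq {H : ℝ} (h0 : 0 < H) (h1 : H < 1) :
    ∫ u in Set.Ioi (0 : ℝ), u ^ (2 * H - 1) / (1 + u ^ 2)
      = Real.pi / (2 * Real.sin (Real.pi * H)) := by
  have key := integral_Ioi_swap
    (f := fun u w : ℝ => u ^ (2 * H - 1) * Real.exp (-(w * (1 + u ^ 2)))) (by fun_prop)
    (fun x hx y hy => by positivity)
  have inner : ∀ w > 0, ∫ u in Set.Ioi (0 : ℝ), u ^ (2 * H - 1) * Real.exp (-(w * (1 + u ^ 2)))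
      = Real.Gamma H / 2 * (w ^ ((1 - H) - 1) * Real.exp (-w)) := by
    intro w hw
    have := integral_rpow_mul_exp_neg_mul_rpow (p := 2) (q := 2 * H - 1) (b := w) (by norm_num)
      (by linarith) hw
    have e : ∀ u : ℝ, u ^ (2 * H - 1) * Real.exp (-(w * (1 + u ^ 2)))
        = Real.exp (-w) * (u ^ (2 * H - 1) * Real.exp (-w * u ^ (2 : ℝ))) := by
      intro u
      rw [show -(w * (1 + u ^ 2)) = -w + -w * u ^ (2 : ℝ) by norm_cast; ring, Real.exp_add]; ring
    simp_rw [e]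
    rw [integral_const_mul, this, show -(2 * H - 1 + 1) / 2 = (1 - H) - 1 by ring,
      show (2 * H - 1 + 1) / 2 = H by ring]
    ring
  have outer : ∫ w in Set.Ioi (0 : ℝ), Real.Gamma H / 2 * (w ^ ((1 - H) - 1) * Real.exp (-w))
      = Real.pi / (2 * Real.sin (Real.pi * H)) := by
    rw [integral_const_mul]
    have := Real.integral_rpow_mul_exp_neg_mul_Ioi (a := 1 - H) (r := 1) (by linarith) one_pos
    simp only [one_mul, div_one, Real.one_rpow] at this
    rw [this, div_mul_eq_mul_div, Real.Gamma_mul_Gamma_one_sub]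
    rw [div_div, mul_comm (Real.sin _)]
  have hs : 0 < Real.sin (Real.pi * H) :=
    Real.sin_pos_of_pos_of_lt_pi (by positivity) (by nlinarith [Real.pi_pos])
  have hG := Real.Gamma_pos_of_pos h0
  have inner' : ∀ u > 0, ∫ w in Set.Ioi (0 : ℝ), u ^ (2 * H - 1) * Real.exp (-(w * (1 + u ^ 2)))
      = u ^ (2 * H - 1) / (1 + u ^ 2) := by
    intro u hu
    have := integral_exp_mul_Ioi (a := -(1 + u ^ 2)) (by nlinarith) 0
    rw [integral_const_mul]
    have e : ∀ w : ℝ, -(w * (1 + u ^ 2)) = -(1 + u ^ 2) * w := fun w => by ring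
    simp_rw [e]
    rw [this]
    rw [neg_div_neg_eq, mul_zero, Real.exp_zero, mul_one_div]
  rw [← outer, ← setIntegral_congr_fun measurableSet_Ioi fun w hw => inner w hw,
    ← setIntegral_congr_fun measurableSet_Ioi fun u hu => inner' u hu]
  apply key
  · intro w hw
    -- A non-integrable function has Bochner integral `0` by convention, so a nonzero value of the
    -- integral proves integrability.
    apply Integrable.of_integral_ne_zero
    rw [inner w hw]
    have : 0 < w := hw
    positivity
  · apply Integrable.of_integral_ne_zero
    rw [setIntegral_congr_fun measurableSet_Ioi fun w hw => inner w hw, outer]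
    positivity

/-- An explicit antiderivative vanishes at infinity; the integrand is nonnegative, so its
integrability needs no separate argument. -/
theorem integral_one_sub_cos_mul_exp {u : ℝ} (hu : 0 < u) :
    ∫ t in Set.Ioi (0 : ℝ), (1 - Real.cos t) * Real.exp (-(u * t)) = 1 / (u * (1 + u ^ 2)) := by
  have hd : ∀ t : ℝ, HasDerivAt (fun t => Real.exp (-(u * t)) *
      (-1 / u + (u * Real.cos t - Real.sin t) / (1 + u ^ 2)))
      ((1 - Real.cos t) * Real.exp (-(u * t))) t := by
    intro t
    have h1 : HasDerivAt (fun t => Real.exp (-(u * t))) (Real.exp (-(u * t)) * -(u * 1)) t :=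
      (((hasDerivAt_id t).const_mul u).neg).exp
    have h2 : HasDerivAt (fun t => -1 / u + (u * Real.cos t - Real.sin t) / (1 + u ^ 2))
        ((u * -Real.sin t - Real.cos t) / (1 + u ^ 2)) t :=
      ((((Real.hasDerivAt_cos t).const_mul u).sub (Real.hasDerivAt_sin t)).div_const _).const_add _
    refine (h1.mul h2).congr_deriv ?_
    have : (1 + u ^ 2) ≠ 0 := by positivity
    field_simp
    ring
  have hlim : Tendsto (fun t => Real.exp (-(u * t)) *
      (-1 / u + (u * Real.cos t - Real.sin t) / (1 + u ^ 2))) atTop (𝓝 0) := by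
    have he : Tendsto (fun t => Real.exp (-(u * t))) atTop (𝓝 0) :=
      Real.tendsto_exp_neg_atTop_nhds_zero.comp (tendsto_id.const_mul_atTop hu)
    refine he.zero_mul_isBoundedUnder_le ?_
    refine isBoundedUnder_of ⟨1 / u + (u + 1), fun t => ?_⟩
    simp only [Function.comp, Real.norm_eq_abs]
    have hc := Real.abs_cos_le_one t
    have hs := Real.abs_sin_le_one t
    calc |-1 / u + (u * Real.cos t - Real.sin t) / (1 + u ^ 2)|
        ≤ |-1 / u| + |(u * Real.cos t - Real.sin t) / (1 + u ^ 2)| := abs_add_le _ _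
      _ ≤ 1 / u + (u + 1) := by
        rw [abs_div, abs_div, abs_neg, abs_one, abs_of_pos hu,
          abs_of_pos (show 0 < 1 + u ^ 2 by positivity)]
        gcongr
        refine (div_le_self (abs_nonneg _) (by nlinarith)).trans ?_
        refine (abs_sub _ _).trans ?_
        rw [abs_mul, abs_of_pos hu]
        nlinarith
  rw [integral_Ioi_of_hasDerivAt_of_nonneg (hd 0).continuousAt.continuousWithinAt
    (fun t _ => hd t) (fun t _ => mul_nonneg (by linarith [Real.cos_le_one t]) (Real.exp_pos _).le)
    hlim]
  have : (1 + u ^ 2) ≠ 0 := by positivity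
  simp
  field_simp
  ring

/-- The Gamma integral `Γ(2H+1) t^{-(2H+1)} = ∫ u^{2H} e^{-ut} du` and Tonelli reduce this to the
Laplace transform of `1 - cos` followed by `integral_rpow_div_one_add_sq`. -/
theorem integral_one_sub_cos_mul_rpow {H : ℝ} (h0 : 0 < H) (h1 : H < 1) :
    ∫ t in Set.Ioi (0 : ℝ), (1 - Real.cos t) * t ^ (-(2 * H + 1))
      = Real.pi / (2 * Real.sin (Real.pi * H) * Real.Gamma (2 * H + 1)) := by
  have hs : 0 < Real.sin (Real.pi * H) :=
    Real.sin_pos_of_pos_of_lt_pi (by positivity) (by nlinarith [Real.pi_pos])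
  have hG : 0 < Real.Gamma (2 * H + 1) := Real.Gamma_pos_of_pos (by linarith)
  have key := integral_Ioi_swap
    (f := fun t u : ℝ => u ^ (2 * H) * ((1 - Real.cos t) * Real.exp (-(u * t)))) (by fun_prop)
    (fun t ht u hu => mul_nonneg (Real.rpow_nonneg hu.le _)
      (mul_nonneg (by linarith [Real.cos_le_one t]) (Real.exp_pos _).le))
  have inner : ∀ u > 0, ∫ t in Set.Ioi (0 : ℝ),
      u ^ (2 * H) * ((1 - Real.cos t) * Real.exp (-(u * t))) = u ^ (2 * H - 1) / (1 + u ^ 2) := by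
    intro u hu
    rw [integral_const_mul, integral_one_sub_cos_mul_exp hu, Real.rpow_sub_one hu.ne']
    field_simp
  have inner' : ∀ t > 0, ∫ u in Set.Ioi (0 : ℝ),
      u ^ (2 * H) * ((1 - Real.cos t) * Real.exp (-(u * t)))
        = Real.Gamma (2 * H + 1) * ((1 - Real.cos t) * t ^ (-(2 * H + 1))) := by
    intro t ht
    have e : ∀ u : ℝ, u ^ (2 * H) * ((1 - Real.cos t) * Real.exp (-(u * t)))
        = (1 - Real.cos t) * (u ^ ((2 * H + 1) - 1) * Real.exp (-(t * u))) := by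
      intro u; rw [add_sub_cancel_right, mul_comm t u]; ring
    simp_rw [e]
    rw [integral_const_mul, Real.integral_rpow_mul_exp_neg_mul_Ioi (by linarith) ht,
      Real.rpow_neg ht.le, one_div, Real.inv_rpow ht.le]
    ring
  rw [setIntegral_congr_fun measurableSet_Ioi fun t ht => inner' t ht,
    setIntegral_congr_fun measurableSet_Ioi fun u hu => inner u hu, integral_const_mul,
    integral_rpow_div_one_add_sq h0 h1] at key
  · have := key ?_ ?_
    · rw [mul_comm, ← eq_div_iff hG.ne', div_div] at this
      exact this
    · intro u hu
      apply Integrable.of_integral_ne_zero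
      rw [inner u hu]
      have : 0 < u := hu
      positivity
    · apply Integrable.of_integral_ne_zero
      rw [setIntegral_congr_fun measurableSet_Ioi fun u hu => inner u hu,
        integral_rpow_div_one_add_sq h0 h1]
      positivity

/-- The constant `∫ |x|^{-(2H+1)} sin²(πx) dx`. -/
noncomputable def fgnIntegral (H : ℝ) : ℝ :=
  (2 * Real.pi) ^ (2 * H) * (Real.pi / (2 * Real.sin (Real.pi * H) * Real.Gamma (2 * H + 1)))

theorem fgnIntegral_pos {H : ℝ} (h0 : 0 < H) (h1 : H < 1) : 0 < fgnIntegral H := by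
  have hs : 0 < Real.sin (Real.pi * H) :=
    Real.sin_pos_of_pos_of_lt_pi (by positivity) (by nlinarith [Real.pi_pos])
  have hG : 0 < Real.Gamma (2 * H + 1) := Real.Gamma_pos_of_pos (by linarith)
  unfold fgnIntegral; positivity

/-- The substitution `t = 2πjx` in `sin² = (1 - cos) / 2`: homogeneity of the power produces
`j^{2H}`, the self-similarity of fGn. -/
theorem integral_abs_rpow_mul_sin_sq {H : ℝ} (h0 : 0 < H) (h1 : H < 1) {j : ℕ} (hj : 1 ≤ j) :
    ∫ x : ℝ, |x| ^ (-(2 * H + 1)) * Real.sin (Real.pi * j * x) ^ 2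
      = fgnIntegral H * (j : ℝ) ^ (2 * H) := by
  have hj0 : (0 : ℝ) < j := by exact_mod_cast hj
  have e1 : ∀ x : ℝ, |x| ^ (-(2 * H + 1)) * Real.sin (Real.pi * j * x) ^ 2
      = |x| ^ (-(2 * H + 1)) * Real.sin (Real.pi * j * |x|) ^ 2 := by
    intro x
    rcases abs_choice x with h | h <;> rw [h]
    simp
  simp_rw [e1]
  rw [integral_comp_abs (f := fun x => x ^ (-(2 * H + 1)) * Real.sin (Real.pi * j * x) ^ 2)]
  have hb : 0 < 2 * Real.pi * j := by positivity
  have e2 : ∀ x ∈ Set.Ioi (0 : ℝ), x ^ (-(2 * H + 1)) * Real.sin (Real.pi * j * x) ^ 2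
      = ((2 * Real.pi * j) ^ (2 * H + 1) / 2) *
        ((1 - Real.cos (2 * Real.pi * j * x)) * (2 * Real.pi * j * x) ^ (-(2 * H + 1))) := by
    intro x hx
    rw [Real.mul_rpow hb.le (le_of_lt hx), Real.rpow_neg hb.le, Real.sin_sq_eq_half_sub]
    rw [show 2 * (Real.pi * j * x) = 2 * Real.pi * j * x by ring]
    have := (Real.rpow_pos_of_pos hb (2 * H + 1)).ne'
    field_simp
  rw [setIntegral_congr_fun measurableSet_Ioi e2, integral_const_mul,
    integral_comp_mul_left_Ioi (fun t => (1 - Real.cos t) * t ^ (-(2 * H + 1))) 0 hb, mul_zero,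
    integral_one_sub_cos_mul_rpow h0 h1, smul_eq_mul, Real.rpow_add_one hb.ne',
    Real.mul_rpow (by positivity) hj0.le]
  unfold fgnIntegral
  field_simp

/-- The periodised kernel `∑_k |k + x|^{-(2H+1)}`. -/
noncomputable def powKernel (H x : ℝ) : ℝ := ∑' k : ℤ, |(k : ℝ) + x| ^ (-(2 * H + 1))

/-- Since `sin²(πjx)` has period 1, the integral over the line unfolds into unit intervals, over
which the translates of the power sum to the kernel. -/
theorem integral_powKernel_mul_sin_sq {H : ℝ} (h0 : 0 < H) (h1 : H < 1) {j : ℕ} (hj : 1 ≤ j) :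
    ∫ x in (-(1 / 2) : ℝ)..(1 / 2), powKernel H x * Real.sin (Real.pi * j * x) ^ 2
      = fgnIntegral H * (j : ℝ) ^ (2 * H) := by
  have hj0 : (0 : ℝ) < j := by exact_mod_cast hj
  set F : ℝ → ℝ := fun x => |x| ^ (-(2 * H + 1)) * Real.sin (Real.pi * j * x) ^ 2 with hF
  have hF0 : ∀ x, 0 ≤ F x := fun x => by simp only [hF]; positivity
  have hI : ∫ x, F x = fgnIntegral H * (j : ℝ) ^ (2 * H) := integral_abs_rpow_mul_sin_sq h0 h1 hj
  have hint : Integrable F := by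
    apply Integrable.of_integral_ne_zero
    rw [hI]
    have := fgnIntegral_pos h0 h1
    positivity
  have hsum := hint.hasSum_intervalIntegral (-(1 / 2))
  have hle : (-(1 / 2) : ℝ) ≤ 1 / 2 := by norm_num
  have e : ∀ n : ℤ, ∫ x in (-(1 / 2) + n : ℝ)..(-(1 / 2) + n + 1), F x
      = ∫ x in Set.Ioc (-(1 / 2) : ℝ) (1 / 2), F (x + n) := by
    intro n
    rw [← intervalIntegral.integral_of_le hle, intervalIntegral.integral_comp_add_right]
    congr 1; ring
  simp_rw [e] at hsum
  have h2 := hasSum_integral_of_summable_integral_norm (ι := ℤ)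
    (μ := volume.restrict (Set.Ioc (-(1 / 2) : ℝ) (1 / 2))) (F := fun n x => F (x + n))
    (fun n => (hint.comp_add_right (n : ℝ)).integrableOn)
    (by simpa only [Real.norm_of_nonneg (hF0 _)] using hsum.summable)
  rw [intervalIntegral.integral_of_le hle, ← hI, ← h2.unique hsum]
  refine integral_congr_ae (ae_of_all _ fun x => ?_)
  simp only [powKernel, hF]
  rw [← tsum_mul_right]
  congr 1; ext k
  rw [add_comm x, show Real.pi * j * (k + x) = Real.pi * j * x + ((j * k : ℤ) : ℝ) * Real.pi by
    push_cast; ring, Real.sin_add_int_mul_pi]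
  congr 1
  rw [mul_pow, ← sq_abs ((-1 : ℝ) ^ _), abs_zpow]
  simp

theorem intervalIntegrable_powKernel_mul_sin_sq {H : ℝ} (h0 : 0 < H) (h1 : H < 1) (j : ℕ) :
    IntervalIntegrable (fun x => powKernel H x * Real.sin (Real.pi * j * x) ^ 2) volume
      (-(1 / 2) : ℝ) (1 / 2) := by
  rcases Nat.eq_zero_or_pos j with rfl | hj
  · simp
  rw [intervalIntegrable_iff_integrableOn_Ioc_of_le (by norm_num)]
  apply Integrable.of_integral_ne_zero
  rw [← intervalIntegral.integral_of_le (by norm_num), integral_powKernel_mul_sin_sq h0 h1 hj]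
  have := fgnIntegral_pos h0 h1
  have : (0 : ℝ) < j := by exact_mod_cast hj
  positivity

/-- The variance of fGn, as an integral. -/
theorem fgnVariance_eq {H : ℝ} (h0 : 0 < H) (h1 : H < 1) (c : ℝ) :
    fgnVariance H c = c * (Real.pi ^ 2)⁻¹ * fgnIntegral H := by
  have hs : 0 < Real.sin (Real.pi * H) :=
    Real.sin_pos_of_pos_of_lt_pi (by positivity) (by nlinarith [Real.pi_pos])
  have hG : 0 < Real.Gamma (2 * H) := Real.Gamma_pos_of_pos (by linarith)
  unfold fgnVariance fgnConst fgnIntegral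
  rw [Real.Gamma_add_one (by linarith), Real.rpow_sub (by positivity), mul_comm H Real.pi]
  have := Real.rpow_pos_of_pos (show 0 < 2 * Real.pi by positivity) (2 * H)
  norm_cast
  field_simp

/-! ### The coefficients of `(1 - B)^{-d}` and their generating function -/

section Coeff

variable {d : ℝ}

theorem fracDiffCoeff_neg_zero (hd : 0 < d) : fracDiffCoeff (-d) 0 = 1 := by
  simp [fracDiffCoeff, (Real.Gamma_pos_of_pos hd).ne']

/-- The functional equation of `Γ`. Monotonicity, size and partial sums of the coefficients all
follow from this recurrence, together with positivity and the initial value. -/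
theorem fracDiffCoeff_neg_succ (hd : 0 < d) (j : ℕ) :
    ((j : ℝ) + 1) * fracDiffCoeff (-d) (j + 1) = (j + d) * fracDiffCoeff (-d) j := by
  have hj : (0 : ℝ) ≤ j := j.cast_nonneg
  have h1 := (Real.Gamma_pos_of_pos hd).ne'
  have h2 := (Real.Gamma_pos_of_pos (show 0 < (j : ℝ) + 1 by linarith)).ne'
  unfold fracDiffCoeff
  push_cast
  rw [neg_neg, sub_neg_eq_add, sub_neg_eq_add, show (j : ℝ) + 1 + d = (j + d) + 1 by ring,
    Real.Gamma_add_one (show (j : ℝ) + d ≠ 0 by linarith),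
    Real.Gamma_add_one (show (j : ℝ) + 1 ≠ 0 by linarith)]
  field_simp

theorem fracDiffCoeff_neg_pos (hd : 0 < d) (j : ℕ) : 0 < fracDiffCoeff (-d) j := by
  have hj : (0 : ℝ) ≤ j := j.cast_nonneg
  unfold fracDiffCoeff
  have h1 := Real.Gamma_pos_of_pos (show 0 < (j : ℝ) - -d by linarith)
  have h2 := Real.Gamma_pos_of_pos (show 0 < - -d by linarith)
  have h3 := Real.Gamma_pos_of_pos (show 0 < (j : ℝ) + 1 by linarith)
  positivity

theorem fracDiffCoeff_neg_antitone (hd : 0 < d) (hd1 : d < 1) :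
    Antitone (fracDiffCoeff (-d)) := by
  refine antitone_nat_of_succ_le fun j => ?_
  have hj : (0 : ℝ) ≤ j := j.cast_nonneg
  have := fracDiffCoeff_neg_succ hd j
  have := fracDiffCoeff_neg_pos hd j
  nlinarith

theorem fracDiffCoeff_neg_le (hd : 0 < d) (hd1 : d < 1) (j : ℕ) :
    fracDiffCoeff (-d) j ≤ ((j : ℝ) + 1) ^ (d - 1) := by
  induction j with
  | zero => simp [fracDiffCoeff_neg_zero hd]
  | succ j ih =>
    have hj : (0 : ℝ) ≤ j := j.cast_nonneg
    have hp : 0 < (j : ℝ) + 1 := by linarith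
    have hb : (1 + 1 / ((j : ℝ) + 1)) ^ (1 - d) ≤ 1 + (1 - d) * (1 / ((j : ℝ) + 1)) :=
      rpow_one_add_le_one_add_mul_self (by have : 0 < 1 / ((j : ℝ) + 1) := by positivity
                                           linarith) (by linarith) (by linarith)
    have hq : 0 < (1 + 1 / ((j : ℝ) + 1)) := by positivity
    have hprod : ((j : ℝ) + 1 + 1) ^ (d - 1)
        = ((j : ℝ) + 1) ^ (d - 1) * ((1 + 1 / ((j : ℝ) + 1)) ^ (1 - d))⁻¹ := by
      rw [← Real.rpow_neg hq.le, neg_sub, ← Real.mul_rpow hp.le hq.le]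
      congr 1; field_simp
    push_cast
    rw [hprod]
    have hrec := fracDiffCoeff_neg_succ hd j
    have h1 : fracDiffCoeff (-d) (j + 1) = (j + d) / (j + 1) * fracDiffCoeff (-d) j := by
      field_simp; linarith
    rw [h1, mul_comm]
    have hfac : ((j : ℝ) + d) / (j + 1) ≤ ((1 + 1 / ((j : ℝ) + 1)) ^ (1 - d))⁻¹ := by
      rw [le_inv_comm₀ (by positivity) (by positivity)]
      refine hb.trans ?_
      rw [inv_div, le_div_iff₀ (by linarith)]
      have : 1 + (1 - d) * (1 / ((j : ℝ) + 1)) = (j + 1 + (1 - d)) / (j + 1) := by field_simp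
      rw [this, div_mul_eq_mul_div, div_le_iff₀ hp]
      -- The inequality is `(j + d)(j + 2 - d) = (j + 1)² - (1 - d)² ≤ (j + 1)²`.
      nlinarith [sq_nonneg (1 - d)]
    exact mul_le_mul ih hfac (by positivity) (by positivity)

/-- Telescoping: with `a_N` the coefficients, the recurrence says `(N + 1) a_{N+1} - N a_N = d a_N`.
-/
theorem sum_fracDiffCoeff_neg (hd : 0 < d) (N : ℕ) :
    d * ∑ j ∈ Finset.range N, fracDiffCoeff (-d) j = N * fracDiffCoeff (-d) N := by
  induction N with
  | zero => simp
  | succ N ih =>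
    have := fracDiffCoeff_neg_succ hd N
    rw [Finset.sum_range_succ, mul_add, ih]
    push_cast
    linarith

theorem sum_fracDiffCoeff_neg_le (hd : 0 < d) (hd1 : d < 1) (N : ℕ) :
    ∑ j ∈ Finset.range N, fracDiffCoeff (-d) j ≤ (N : ℝ) ^ d / d := by
  rw [le_div_iff₀' hd, sum_fracDiffCoeff_neg hd]
  rcases Nat.eq_zero_or_pos N with rfl | hN
  · simp [Real.zero_rpow hd.ne']
  have hN0 : (0 : ℝ) < N := by exact_mod_cast hN
  calc (N : ℝ) * fracDiffCoeff (-d) N ≤ N * (N : ℝ) ^ (d - 1) := by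
        gcongr
        exact (fracDiffCoeff_neg_le hd hd1 N).trans
          (Real.rpow_le_rpow_of_nonpos hN0 (by linarith) (by linarith))
    _ = (N : ℝ) ^ d := by rw [Real.rpow_sub_one hN0.ne']; field_simp

theorem tendsto_fracDiffCoeff_neg (hd : 0 < d) (hd1 : d < 1) :
    Tendsto (fracDiffCoeff (-d)) atTop (𝓝 0) := by
  have h : Tendsto (fun j : ℕ => ((j : ℝ) + 1) ^ (-(1 - d))) atTop (𝓝 0) :=
    (tendsto_rpow_neg_atTop (show 0 < 1 - d by linarith)).comp
      (tendsto_atTop_add_const_right _ _ tendsto_natCast_atTop_atTop)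
  refine squeeze_zero (fun j => (fracDiffCoeff_neg_pos hd j).le) (fun j => ?_) h
  rw [neg_sub]
  exact fracDiffCoeff_neg_le hd hd1 j

/-- Summation by parts against a unimodular geometric sequence. -/
theorem norm_one_sub_mul_sum_Ico_le {a : ℕ → ℝ} (ha : Antitone a) (ha0 : ∀ j, 0 ≤ a j) {z : ℂ}
    (hz : ‖z‖ = 1) {M N : ℕ} (hMN : M ≤ N) :
    ‖1 - z‖ * ‖∑ j ∈ Finset.Ico M N, (a j : ℂ) * z ^ j‖ ≤ 2 * a M := by
  have key : (1 - z) * ∑ j ∈ Finset.Ico M N, (a j : ℂ) * z ^ j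
      = a M * z ^ M - a N * z ^ N
        + ∑ j ∈ Finset.Ico M N, ((a (j + 1) - a j : ℝ) : ℂ) * z ^ (j + 1) := by
    induction N, hMN using Nat.le_induction with
    | base => simp
    | succ N hN ih =>
      rw [Finset.sum_Ico_succ_top hN, Finset.sum_Ico_succ_top hN, mul_add, ih]
      push_cast; ring
  have hn : ∀ (c : ℝ) (j : ℕ), ‖(c : ℂ) * z ^ j‖ = |c| := fun c j => by simp [hz]
  have hs : ‖∑ j ∈ Finset.Ico M N, ((a (j + 1) - a j : ℝ) : ℂ) * z ^ (j + 1)‖ ≤ a M - a N := by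
    refine (norm_sum_le _ _).trans ?_
    simp_rw [hn]
    have : ∀ j ∈ Finset.Ico M N, |a (j + 1) - a j| = -(a (j + 1) - a j) := fun j _ =>
      abs_of_nonpos (by linarith [ha (Nat.le_succ j)])
    rw [Finset.sum_congr rfl this, Finset.sum_neg_distrib, Finset.sum_Ico_sub _ hMN]
    linarith
  rw [← norm_mul, key]
  calc _ ≤ ‖(a M : ℂ) * z ^ M‖ + ‖(a N : ℂ) * z ^ N‖ + _ :=
        (norm_add_le _ _).trans (add_le_add_left (norm_sub_le _ _) _)
    _ ≤ a M + a N + (a M - a N) := by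
        rw [hn, hn, abs_of_nonneg (ha0 M), abs_of_nonneg (ha0 N)]; gcongr
    _ = 2 * a M := by ring

/-- Partial sums of the binomial series of `(1 - z)^{-d}`. -/
noncomputable def binomPartial (d : ℝ) (N : ℕ) (z : ℂ) : ℂ :=
  ∑ j ∈ Finset.range N, (fracDiffCoeff (-d) j : ℂ) * z ^ j

/-- A bound uniform in `N`, to serve as dominating function: for `d = H - 1/2` its square has
exponent `-(2H - 1) > -1`, hence is integrable near `z = 1`. Up to an index of order `1 / ‖1 - z‖`
the triangle inequality suffices; beyond it, summation by parts exploits the oscillation. -/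
theorem norm_binomPartial_le (hd : 0 < d) (hd1 : d < 1) {z : ℂ} (hz : ‖z‖ = 1) (hz1 : z ≠ 1)
    (N : ℕ) : ‖binomPartial d N z‖ ≤ (4 / d + 2) * ‖1 - z‖ ^ (-d) := by
  have hr : 0 < ‖1 - z‖ := norm_pos_iff.2 (sub_ne_zero.2 hz1.symm)
  have hr2 : ‖1 - z‖ ≤ 2 := (norm_sub_le _ _).trans (by rw [hz, norm_one]; norm_num)
  set r := ‖1 - z‖
  -- As `r ≤ 2`, the number `2 / r` is at least 1, so rounding it up keeps `M ≤ 4 / r`.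
  set M := ⌈2 / r⌉₊
  have hM1 : 2 / r ≤ M := Nat.le_ceil _
  have hM2 : (M : ℝ) ≤ 4 / r := by
    have h1 := (Nat.ceil_lt_add_one (show 0 ≤ 2 / r by positivity)).le
    have h2 : 1 ≤ 2 / r := by rw [le_div_iff₀ hr]; linarith
    have h3 : 4 / r = 2 / r + 2 / r := by ring
    linarith
  have hr' : r ^ (-d) = (1 / r) ^ d := by rw [Real.rpow_neg hr.le, one_div, Real.inv_rpow hr.le]
  have hsmall : ∀ K : ℕ, K ≤ M → ‖binomPartial d K z‖ ≤ 4 / d * r ^ (-d) := by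
    intro K hK
    have h1 : ‖binomPartial d K z‖ ≤ ∑ j ∈ Finset.range K, fracDiffCoeff (-d) j := by
      refine (norm_sum_le _ _).trans (le_of_eq (Finset.sum_congr rfl fun j _ => ?_))
      rw [norm_mul, norm_pow, hz, one_pow, mul_one, Complex.norm_real,
        Real.norm_of_nonneg (fracDiffCoeff_neg_pos hd j).le]
    refine h1.trans ((sum_fracDiffCoeff_neg_le hd hd1 K).trans ?_)
    have h2 : (K : ℝ) ^ d ≤ (4 / r) ^ d :=
      Real.rpow_le_rpow K.cast_nonneg ((Nat.cast_le.2 hK).trans hM2) hd.le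
    have h3 : (4 / r) ^ d ≤ 4 * r ^ (-d) := by
      rw [div_eq_mul_one_div, Real.mul_rpow (by norm_num) (by positivity), hr']
      gcongr
      calc (4 : ℝ) ^ d ≤ 4 ^ (1 : ℝ) := Real.rpow_le_rpow_of_exponent_le (by norm_num) hd1.le
        _ = 4 := Real.rpow_one 4
    calc (K : ℝ) ^ d / d ≤ (4 * r ^ (-d)) / d := by gcongr; exact h2.trans h3
      _ = 4 / d * r ^ (-d) := by ring
  rcases le_total N M with hN | hN
  · refine (hsmall N hN).trans ?_
    have := Real.rpow_pos_of_pos hr (-d)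
    nlinarith
  have hsplit : binomPartial d N z = binomPartial d M z
      + ∑ j ∈ Finset.Ico M N, (fracDiffCoeff (-d) j : ℂ) * z ^ j := by
    unfold binomPartial
    rw [Finset.sum_range_add_sum_Ico _ hN]
  have hparts := norm_one_sub_mul_sum_Ico_le (fracDiffCoeff_neg_antitone hd hd1)
    (fun j => (fracDiffCoeff_neg_pos hd j).le) hz hN
  have haM : fracDiffCoeff (-d) M ≤ r * r ^ (-d) := by
    have h1 := fracDiffCoeff_neg_le hd hd1 M
    have h2 : ((M : ℝ) + 1) ^ (d - 1) ≤ (1 / r) ^ (d - 1) := by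
      refine Real.rpow_le_rpow_of_nonpos (by positivity) ?_ (by linarith)
      have : 2 / r = 1 / r + 1 / r := by ring
      have : 0 < 1 / r := by positivity
      linarith
    refine (h1.trans h2).trans (le_of_eq ?_)
    rw [Real.rpow_sub_one (by positivity), hr']
    field_simp
  have htail : ‖∑ j ∈ Finset.Ico M N, (fracDiffCoeff (-d) j : ℂ) * z ^ j‖ ≤ 2 * r ^ (-d) := by
    have : r * ‖∑ j ∈ Finset.Ico M N, (fracDiffCoeff (-d) j : ℂ) * z ^ j‖
      ≤ r * (2 * r ^ (-d)) := by linarith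
    exact le_of_mul_le_mul_left this hr
  rw [hsplit, add_mul]
  exact (norm_add_le _ _).trans (add_le_add (hsmall M le_rfl) htail)

/-- Both sides satisfy the same recurrence; this identifies the coefficients with those of the power
series of `(1 - z)^{-d}` in the open disc. -/
theorem ringChoose_eq_fracDiffCoeff (hd : 0 < d) (n : ℕ) :
    Ring.choose ((d : ℂ) + n - 1) n = (fracDiffCoeff (-d) n : ℂ) := by
  have h1 : Ring.choose ((d : ℂ) + n - 1) n = Ring.multichoose (d : ℂ) n := by
    rw [Ring.choose]; congr 1; ring
  have h2 := Ring.factorial_nsmul_multichoose_eq_ascPochhammer (d : ℂ) n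
  rw [Polynomial.ascPochhammer_smeval_eq_eval] at h2
  have h3 : ∀ n : ℕ, (ascPochhammer ℂ n).eval (d : ℂ)
      = (n.factorial : ℂ) * (fracDiffCoeff (-d) n : ℂ) := by
    intro n
    induction n with
    | zero => simp [fracDiffCoeff_neg_zero hd]
    | succ n ih =>
      rw [ascPochhammer_succ_eval, ih, Nat.factorial_succ]
      have := fracDiffCoeff_neg_succ hd n
      have hc : ((n : ℂ) + 1) * (fracDiffCoeff (-d) (n + 1) : ℂ)
          = (n + d) * (fracDiffCoeff (-d) n : ℂ) := by exact_mod_cast this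
      push_cast
      linear_combination -(n.factorial : ℂ) * hc
  rw [h3, nsmul_eq_mul] at h2
  rw [h1]
  exact mul_left_cancel₀ (by exact_mod_cast n.factorial_ne_zero) h2

/-- Summation by parts makes the partial sums Cauchy on the circle away from 1. Abel's theorem then
identifies their limit with the radial limit of the closed form known inside the disc. -/
theorem tendsto_binomPartial (hd : 0 < d) (hd1 : d < 1) {z : ℂ} (hz : ‖z‖ = 1) (hz1 : z ≠ 1) :
    Tendsto (fun N => binomPartial d N z) atTop (𝓝 (1 / (1 - z) ^ (d : ℂ))) := by
  have hr : 0 < ‖1 - z‖ := norm_pos_iff.2 (sub_ne_zero.2 hz1.symm)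
  -- This keeps `1 - z` off the branch cut, so the complex power is continuous there.
  have hre : 0 < (1 - z).re := by
    have h1 : z.re ≤ 1 := (Complex.re_le_norm z).trans hz.le
    rcases h1.lt_or_eq with h | h
    · simpa using h
    · exact absurd (Complex.ext h (by
        have := Complex.sq_norm z
        rw [Complex.normSq_apply, hz, h] at this
        have : z.im * z.im = 0 := by linarith
        simpa using this)) hz1
  have hcs : CauchySeq (fun N => binomPartial d N z) := by
    refine cauchySeq_of_le_tendsto_0' (fun N => 2 * fracDiffCoeff (-d) N / ‖1 - z‖)
      (fun M N hMN => ?_) ?_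
    · rw [dist_comm, dist_eq_norm, le_div_iff₀' hr]
      have : binomPartial d N z - binomPartial d M z
          = ∑ j ∈ Finset.Ico M N, (fracDiffCoeff (-d) j : ℂ) * z ^ j := by
        unfold binomPartial
        rw [Finset.sum_Ico_eq_sub _ hMN]
      rw [this]
      exact norm_one_sub_mul_sum_Ico_le (fracDiffCoeff_neg_antitone hd hd1)
        (fun j => (fracDiffCoeff_neg_pos hd j).le) hz hMN
    · simpa using ((tendsto_fracDiffCoeff_neg hd hd1).const_mul 2).div_const ‖1 - z‖
  obtain ⟨l, hl⟩ := cauchySeq_tendsto_of_complete hcs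
  have habel := Complex.tendsto_tsum_powerSeries_nhdsWithin_lt hl
  rw [tendsto_map'_iff] at habel
  have hser : ∀ᶠ r : ℝ in 𝓝[<] 1,
      ∑' n, (fracDiffCoeff (-d) n : ℂ) * z ^ n * (r : ℂ) ^ n = 1 / (1 - r * z) ^ (d : ℂ) := by
    filter_upwards [Ioo_mem_nhdsLT (show (0 : ℝ) < 1 by norm_num)] with r hr
    have hb : (r : ℂ) * z ∈ Metric.eball (0 : ℂ) 1 := by
      rw [mem_eball_zero_iff, ← ofReal_norm, norm_mul, hz, mul_one, Complex.norm_real,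
        Real.norm_of_nonneg hr.1.le]
      exact ENNReal.ofReal_lt_one.2 hr.2
    have := (Complex.one_div_one_sub_cpow_hasFPowerSeriesOnBall_zero (d : ℂ)).hasSum hb
    rw [zero_add] at this
    rw [← this.tsum_eq]
    congr 1; ext n
    rw [FormalMultilinearSeries.ofScalars_apply_eq, ringChoose_eq_fracDiffCoeff hd, smul_eq_mul,
      mul_pow]
    ring
  have hlim : Tendsto (fun r : ℝ => 1 / (1 - (r : ℂ) * z) ^ (d : ℂ)) (𝓝[<] 1)
      (𝓝 (1 / (1 - z) ^ (d : ℂ))) := by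
    have hc : ContinuousAt (fun r : ℝ => 1 / (1 - (r : ℂ) * z) ^ (d : ℂ)) 1 := by
      have hne : (1 - ((1 : ℝ) : ℂ) * z) ^ (d : ℂ) ≠ 0 := by
        rw [Complex.ofReal_one, one_mul, Ne, Complex.cpow_eq_zero_iff, not_and_or]
        exact Or.inl (norm_pos_iff.1 hr)
      refine ContinuousAt.div continuousAt_const ?_ hne
      refine ContinuousAt.cpow (by fun_prop) continuousAt_const ?_
      left; simpa using hre
    have := hc.tendsto.mono_left (nhdsWithin_le_nhds (s := Set.Iio 1))
    simpa using this
  have hu := tendsto_nhds_unique (habel.congr' (by filter_upwards [hser] with r h using h)) hlim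
  rwa [hu] at hl

theorem tendsto_norm_binomPartial (hd : 0 < d) (hd1 : d < 1) {z : ℂ} (hz : ‖z‖ = 1)
    (hz1 : z ≠ 1) :
    Tendsto (fun N => ‖binomPartial d N z‖ ^ 2) atTop (𝓝 (‖1 - z‖ ^ (-(2 * d)))) := by
  have hr : 1 - z ≠ 0 := sub_ne_zero.2 hz1.symm
  have := ((tendsto_binomPartial hd hd1 hz hz1).norm).pow 2
  rwa [norm_div, norm_one, Complex.norm_cpow_real, div_pow, one_pow, one_div,
    ← Real.rpow_mul_natCast (norm_nonneg _), ← Real.rpow_neg (norm_nonneg _), Nat.cast_ofNat,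
    mul_comm d] at this

end Coeff

theorem norm_one_sub_exp (θ : ℝ) :
    ‖1 - Complex.exp ((2 * Real.pi * θ : ℝ) * Complex.I)‖ = |2 * Real.sin (Real.pi * θ)| := by
  rw [← sq_eq_sq₀ (norm_nonneg _) (abs_nonneg _), sq_abs, Complex.sq_norm, Complex.normSq_apply,
    Complex.sub_re, Complex.sub_im, Complex.exp_ofReal_mul_I_re, Complex.exp_ofReal_mul_I_im,
    show 2 * Real.pi * θ = 2 * (Real.pi * θ) by ring, Real.cos_two_mul, Real.sin_two_mul]
  have := Real.sin_sq_add_cos_sq (Real.pi * θ)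
  simp
  nlinarith

/-! ### Integrability of powers and trigonometric kernels -/

theorem intervalIntegrable_finset_sum {ι : Type*} (s : Finset ι) {F : ι → ℝ → ℝ} {a b : ℝ}
    (hF : ∀ i, IntervalIntegrable (F i) volume a b) :
    IntervalIntegrable (fun x => ∑ i ∈ s, F i x) volume a b := by
  simpa only [Finset.sum_fn] using IntervalIntegrable.sum s fun i _ => hF i

theorem intervalIntegrable_abs_rpow {r : ℝ} (hr : -1 < r) (a b : ℝ) :
    IntervalIntegrable (fun x : ℝ => |x| ^ r) volume a b := by
  have hpos : ∀ c : ℝ, 0 ≤ c → IntervalIntegrable (fun x : ℝ => |x| ^ r) volume 0 c := by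
    intro c hc
    refine (intervalIntegral.intervalIntegrable_rpow' hr).congr (fun x hx => ?_)
    rw [Set.uIoc_of_le hc] at hx
    simp only [abs_of_pos hx.1]
  have h0 : ∀ c : ℝ, IntervalIntegrable (fun x : ℝ => |x| ^ r) volume 0 c := by
    intro c
    rcases le_total 0 c with hc | hc
    · exact hpos c hc
    · rw [IntervalIntegrable.iff_comp_neg]
      simpa using hpos (-c) (by linarith)
  exact (h0 a).symm.trans (h0 b)

/-- Jordan's inequality; it transfers the integrability of `|x|^r` to powers of `|2 sin πx|`. -/
theorem four_mul_abs_le {x : ℝ} (hx : |x| ≤ 1 / 2) : 4 * |x| ≤ |2 * Real.sin (Real.pi * x)| := by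
  have := Real.mul_abs_le_abs_sin (x := Real.pi * x) (by
    rw [abs_mul, abs_of_pos Real.pi_pos]; nlinarith [Real.pi_pos])
  rw [abs_mul, abs_of_pos Real.pi_pos, ← mul_assoc, div_mul_cancel₀ _ Real.pi_ne_zero] at this
  rw [abs_mul, abs_two]
  linarith

theorem sin_pi_mul_ne_zero {x : ℝ} (hx : |x| ≤ 1 / 2) (hx0 : x ≠ 0) :
    Real.sin (Real.pi * x) ≠ 0 := by
  intro h
  have := four_mul_abs_le hx
  rw [h, mul_zero, abs_zero] at this
  exact hx0 (abs_eq_zero.1 (le_antisymm (by linarith) (abs_nonneg x)))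

theorem abs_le_half_of_mem {x : ℝ} (hx : x ∈ Set.Icc (-(1 / 2) : ℝ) (1 / 2)) : |x| ≤ 1 / 2 :=
  abs_le.2 hx

theorem mem_Icc_of_mem_uIoc {x : ℝ} (hx : x ∈ Set.uIoc (-(1 / 2) : ℝ) (1 / 2)) :
    x ∈ Set.Icc (-(1 / 2) : ℝ) (1 / 2) := by
  rw [Set.uIoc_of_le (by norm_num)] at hx
  exact Set.Ioc_subset_Icc_self hx

theorem uIcc_half : Set.uIcc (-(1 / 2) : ℝ) (1 / 2) = Set.Icc (-(1 / 2) : ℝ) (1 / 2) :=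
  Set.uIcc_of_le (by norm_num)

theorem ae_ne_zero : ∀ᵐ x : ℝ, x ≠ 0 := by
  simp [ae_iff, measure_singleton]

theorem intervalIntegrable_abs_two_sin_rpow {r : ℝ} (hr : -1 < r) (hr0 : r ≤ 0) :
    IntervalIntegrable (fun x : ℝ => |2 * Real.sin (Real.pi * x)| ^ r) volume
      (-(1 / 2) : ℝ) (1 / 2) := by
  refine ((intervalIntegrable_abs_rpow hr _ _).const_mul (4 ^ r)).mono_fun'
    (Measurable.aestronglyMeasurable (by fun_prop)) ?_
  filter_upwards [ae_restrict_mem measurableSet_uIoc, ae_restrict_of_ae ae_ne_zero] with x hx hx0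
  have hx' := abs_le_half_of_mem (mem_Icc_of_mem_uIoc hx)
  rw [Real.norm_of_nonneg (by positivity), ← Real.mul_rpow (by norm_num) (abs_nonneg x)]
  exact Real.rpow_le_rpow_of_nonpos (by have := abs_pos.2 hx0; positivity) (four_mul_abs_le hx') hr0

theorem intervalIntegrable_fracSpectralDensity {H : ℝ} (hH : 1 / 2 < H) (hH1 : H < 1) {h : ℝ → ℝ}
    (hcont : ContinuousOn h (Set.Icc (-(1 / 2) : ℝ) (1 / 2))) :
    IntervalIntegrable (fracSpectralDensity H h) volume (-(1 / 2) : ℝ) (1 / 2) := by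
  have := (intervalIntegrable_abs_two_sin_rpow (r := -(2 * H - 1)) (by linarith)
    (by linarith)).mul_continuousOn (uIcc_half ▸ hcont)
  exact this.congr (fun x _ => by simp only [fracSpectralDensity]; ring)

/-! ### Trigonometric identities -/

/-- Expand `e^{ikθ} A Ā` and take real parts. It is applied to the coefficients of the fractional
filter and, with all coefficients 1, to aggregation. -/
theorem sum_sum_mul_cos (N : ℕ) (a : ℕ → ℝ) (θ k : ℝ) :
    ∑ i ∈ Finset.range N, ∑ j ∈ Finset.range N, a i * a j * Real.cos ((k + i - j) * θ)
      = Real.cos (k * θ)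
        * ‖∑ j ∈ Finset.range N, (a j : ℂ) * Complex.exp (θ * Complex.I) ^ j‖ ^ 2 := by
  set A := ∑ j ∈ Finset.range N, (a j : ℂ) * Complex.exp (θ * Complex.I) ^ j with hA
  have hcA : (starRingEnd ℂ) A = ∑ j ∈ Finset.range N, (a j : ℂ) * Complex.exp (-(j * θ) * Complex.I) := by
    rw [hA, map_sum]
    refine Finset.sum_congr rfl fun j _ => ?_
    rw [map_mul, map_pow, Complex.conj_ofReal, ← Complex.exp_conj, ← Complex.exp_nat_mul]
    simp
    left; congr 1; ring
  have h1 : Complex.exp (((k * θ : ℝ) : ℂ) * Complex.I) * ((‖A‖ ^ 2 : ℝ) : ℂ)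
      = ∑ i ∈ Finset.range N, ∑ j ∈ Finset.range N,
        ((a i * a j : ℝ) : ℂ) * Complex.exp ((((k + i - j) * θ : ℝ) : ℂ) * Complex.I) := by
    rw [Complex.ofReal_pow, ← Complex.mul_conj' A, hcA, hA, Finset.sum_mul_sum, Finset.mul_sum]
    refine Finset.sum_congr rfl fun i _ => ?_
    rw [Finset.mul_sum]
    refine Finset.sum_congr rfl fun j _ => ?_
    rw [← Complex.exp_nat_mul, show ((((k + i - j) * θ : ℝ) : ℂ) * Complex.I)
      = ((k * θ : ℝ) : ℂ) * Complex.I + i * (θ * Complex.I) + -(j * θ) * Complex.I by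
        push_cast; ring, Complex.exp_add, Complex.exp_add]
    push_cast
    ring
  have h2 := congrArg Complex.re h1
  rw [Complex.re_mul_ofReal, Complex.exp_ofReal_mul_I_re, Complex.re_sum] at h2
  rw [h2]
  refine Finset.sum_congr rfl fun i _ => ?_
  rw [Complex.re_sum]
  refine Finset.sum_congr rfl fun j _ => ?_
  rw [Complex.re_ofReal_mul, Complex.exp_ofReal_mul_I_re]

theorem sum_Icc_neg_succ (f : ℤ → ℝ) (k : ℕ) :
    ∑ i ∈ Finset.Icc (-((k + 1 : ℕ) : ℤ)) ((k + 1 : ℕ) : ℤ), f i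
      = ∑ i ∈ Finset.Icc (-(k : ℤ)) (k : ℤ), f i + (f (k + 1) + f (-(k + 1))) := by
  have h : Finset.Icc (-((k + 1 : ℕ) : ℤ)) ((k + 1 : ℕ) : ℤ)
      = insert ((k : ℤ) + 1) (insert (-((k : ℤ) + 1)) (Finset.Icc (-(k : ℤ)) (k : ℤ))) := by
    ext i; simp only [Finset.mem_Icc, Finset.mem_insert]; push_cast; omega
  rw [h, Finset.sum_insert, Finset.sum_insert]
  · ring
  · simp
  · simp only [Finset.mem_insert, Finset.mem_Icc]; omega

theorem sum_cos_mul_sin (k : ℕ) (y : ℝ) :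
    (∑ i ∈ Finset.Icc (-(k : ℤ)) (k : ℤ), Real.cos (2 * y * i)) * Real.sin y
      = Real.sin ((2 * k + 1) * y) := by
  induction k with
  | zero => simp
  | succ k ih =>
    rw [sum_Icc_neg_succ, add_mul, ih]
    push_cast
    rw [show 2 * y * -((k : ℝ) + 1) = -(2 * y * (k + 1)) by ring, Real.cos_neg,
      show (2 * ((k : ℝ) + 1) + 1) * y = 2 * y * (k + 1) + y by ring,
      show (2 * (k : ℝ) + 1) * y = 2 * y * (k + 1) - y by ring, Real.sin_add, Real.sin_sub]
    ring

/-- Fejér's identity. -/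
theorem doubleSum_cos_mul_sin_sq (n : ℕ) (y : ℝ) :
    doubleSum (fun k => Real.cos (2 * y * k)) n * Real.sin y ^ 2 = Real.sin (n * y) ^ 2 := by
  unfold doubleSum
  induction n with
  | zero => simp
  | succ n ih =>
    rw [Finset.sum_range_succ, add_mul, ih, sq (Real.sin y), ← mul_assoc, sum_cos_mul_sin]
    push_cast
    rw [show (2 * (n : ℝ) + 1) * y = n * y + (n + 1) * y by ring,
      show Real.sin y = Real.sin ((n + 1) * y - n * y) by congr 1; ring, Real.sin_add,
      Real.sin_sub]
    have h1 := Real.sin_sq_add_cos_sq (n * y)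
    have h2 := Real.sin_sq_add_cos_sq (((n : ℝ) + 1) * y)
    linear_combination Real.sin (n * y) ^ 2 * (-h2) + Real.sin ((n + 1) * y) ^ 2 * h1

theorem norm_sum_exp_sq_mul_sin_sq (m : ℕ) (x : ℝ) :
    ‖∑ j ∈ Finset.range m, ((1 : ℝ) : ℂ) * Complex.exp ((2 * Real.pi * x : ℝ) * Complex.I) ^ j‖ ^ 2
      * Real.sin (Real.pi * x) ^ 2 = Real.sin (Real.pi * m * x) ^ 2 := by
  set z := Complex.exp ((2 * Real.pi * x : ℝ) * Complex.I) with hz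
  have h1 : (∑ j ∈ Finset.range m, ((1 : ℝ) : ℂ) * z ^ j) * (1 - z) = 1 - z ^ m := by
    simp only [Complex.ofReal_one, one_mul]
    rw [← neg_sub z, mul_neg, geom_sum_mul, neg_sub]
  have h2 : z ^ m = Complex.exp ((2 * Real.pi * (m * x) : ℝ) * Complex.I) := by
    rw [hz, ← Complex.exp_nat_mul]; congr 1; push_cast; ring
  have h3 := congrArg (fun w => ‖w‖ ^ 2) h1
  simp only [norm_mul] at h3
  rw [h2, norm_one_sub_exp, hz, norm_one_sub_exp, mul_pow, sq_abs, sq_abs] at h3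
  rw [show Real.pi * m * x = Real.pi * (m * x) by ring]
  linarith

/-! ### Covariances of the fractionally differenced process -/

section SecondOrder

variable {Ω : Type*} [MeasurableSpace Ω] {μ : Measure Ω}

theorem integral_mul_eq_inner {u v : Ω → ℝ} (hu : MemLp u 2 μ) (hv : MemLp v 2 μ) :
    ∫ w, (u * v) w ∂μ = inner ℝ (hu.toLp u) (hv.toLp v) := by
  rw [L2.inner_def]
  refine integral_congr_ae ?_
  filter_upwards [hu.coeFn_toLp, hv.coeFn_toLp] with w h1 h2
  rw [h1, h2]
  simp [mul_comm]

/-- Once the means are written as inner products with the constant 1, covariance is a polynomial in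
L² inner products, hence continuous. -/
theorem tendsto_covariance [IsProbabilityMeasure μ] {U V : ℕ → Ω → ℝ} {u v : Ω → ℝ} (hU : ∀ N, MemLp (U N) 2 μ)
    (hV : ∀ N, MemLp (V N) 2 μ) (hu : MemLp u 2 μ) (hv : MemLp v 2 μ)
    (hUu : Tendsto (fun N => eLpNorm (u - U N) 2 μ) atTop (𝓝 0))
    (hVv : Tendsto (fun N => eLpNorm (v - V N) 2 μ) atTop (𝓝 0)) :
    Tendsto (fun N => covariance (U N) (V N) μ) atTop (𝓝 (covariance u v μ)) := by
  have lift : ∀ {W : ℕ → Ω → ℝ} {w : Ω → ℝ} (hW : ∀ N, MemLp (W N) 2 μ) (hw : MemLp w 2 μ),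
      Tendsto (fun N => eLpNorm (w - W N) 2 μ) atTop (𝓝 0) →
      Tendsto (fun N => (hW N).toLp (W N)) atTop (𝓝 (hw.toLp w)) := by
    intro W w hW hw h
    rw [Lp.tendsto_Lp_iff_tendsto_eLpNorm'']
    simpa only [eLpNorm_sub_comm] using h
  have h1 : MemLp (1 : Ω → ℝ) 2 μ := memLp_const 1
  have mean : ∀ {w : Ω → ℝ} (hw : MemLp w 2 μ),
      ∫ x, w x ∂μ = inner ℝ (h1.toLp 1) (hw.toLp w) := by
    intro w hw
    rw [← integral_mul_eq_inner h1 hw, one_mul]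
  have hUl := lift hU hu hUu
  have hVl := lift hV hv hVv
  have heq : ∀ N, covariance (U N) (V N) μ = inner ℝ ((hU N).toLp (U N)) ((hV N).toLp (V N))
      - inner ℝ (h1.toLp 1) ((hU N).toLp (U N)) * inner ℝ (h1.toLp 1) ((hV N).toLp (V N)) := by
    intro N
    rw [covariance_eq_sub (hU N) (hV N), integral_mul_eq_inner (hU N) (hV N), mean (hU N),
      mean (hV N)]
  rw [covariance_eq_sub hu hv, integral_mul_eq_inner hu hv, mean hu, mean hv]
  simp_rw [heq]
  exact (hUl.inner hVl).sub ((tendsto_const_nhds.inner hUl).mul (tendsto_const_nhds.inner hVl))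

variable {h : ℝ → ℝ} {X Y : ℤ → Ω → ℝ}

theorem covariance_eq_integral_cos (hcont : ContinuousOn h (Set.Icc (-(1 / 2) : ℝ) (1 / 2)))
    (hYh : HasSpectralDensity μ Y h) (s t : ℤ) :
    covariance (Y s) (Y t) μ = ∫ x in (-(1 / 2) : ℝ)..(1 / 2),
      h x * Real.cos (((t : ℝ) - s) * (2 * Real.pi * x)) := by
  have := congrArg Complex.re (hYh.covariance_eq s t)
  rw [Complex.ofReal_re] at this
  rw [this, ← Complex.reCLM_apply, ← Complex.reCLM.intervalIntegral_comp_comm]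
  · refine intervalIntegral.integral_congr fun x _ => ?_
    simp only [Complex.reCLM_apply]
    rw [Complex.re_ofReal_mul, show (2 * Real.pi * Complex.I * ((t : ℂ) - (s : ℂ)) * (x : ℂ))
      = (((t : ℝ) - s) * (2 * Real.pi * x) : ℝ) * Complex.I by push_cast; ring,
      Complex.exp_ofReal_mul_I_re]
  · refine ContinuousOn.intervalIntegrable ?_
    rw [uIcc_half]
    exact (Complex.continuous_ofReal.comp_continuousOn hcont).mul (by fun_prop)

theorem covariance_partial_sum [IsProbabilityMeasure μ]
    (hcont : ContinuousOn h (Set.Icc (-(1 / 2) : ℝ) (1 / 2)))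
    (hY : ∀ t, MemLp (Y t) 2 μ) (hYh : HasSpectralDensity μ Y h) (a : ℕ → ℝ) (N : ℕ) (s t : ℤ) :
    covariance (fun w => ∑ j ∈ Finset.range N, a j * Y (s - (j : ℤ)) w)
      (fun w => ∑ j ∈ Finset.range N, a j * Y (t - (j : ℤ)) w) μ
    = ∫ x in (-(1 / 2) : ℝ)..(1 / 2), h x * (Real.cos (((t : ℝ) - s) * (2 * Real.pi * x))
        * ‖∑ j ∈ Finset.range N, (a j : ℂ) *
            Complex.exp ((2 * Real.pi * x : ℝ) * Complex.I) ^ j‖ ^ 2) := by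
  rw [covariance_fun_sum_fun_sum' (fun j _ => (hY _).const_mul _) (fun j _ => (hY _).const_mul _)]
  simp_rw [← sum_sum_mul_cos, Finset.mul_sum]
  have hint : ∀ i j : ℕ, IntervalIntegrable
      (fun x => h x * (a i * a j * Real.cos (((t : ℝ) - s + i - j) * (2 * Real.pi * x))))
      volume (-(1 / 2) : ℝ) (1 / 2) := by
    intro i j
    refine ContinuousOn.intervalIntegrable ?_
    rw [uIcc_half]
    exact hcont.mul (by fun_prop)
  rw [intervalIntegral.integral_finsetSum fun i _ => intervalIntegrable_finset_sum _ (hint i)]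
  refine Finset.sum_congr rfl fun i _ => ?_
  rw [intervalIntegral.integral_finsetSum fun j _ => hint i j]
  refine Finset.sum_congr rfl fun j _ => ?_
  rw [covariance_const_mul_left, covariance_const_mul_right, covariance_eq_integral_cos hcont hYh,
    ← intervalIntegral.integral_const_mul, ← intervalIntegral.integral_const_mul]
  refine intervalIntegral.integral_congr fun x _ => ?_
  push_cast
  rw [show ((t : ℝ) - j - (s - i)) = t - s + i - j by ring]
  ring

/-- The truncated filters have covariances `∫ h cos |A_N|²`, with `A_N` the binomial partial sum at
`z = e^{2πix}`. The left side converges by continuity of covariance in L²; on the right `|A_N|²`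
tends to `|1 - z|^{-2d} = |2 sin πx|^{-(2H-1)}`, dominated through `norm_binomPartial_le`. -/
theorem covariance_fracDiff [IsProbabilityMeasure μ] {H : ℝ} (hH : 1 / 2 < H) (hH1 : H < 1)
    (hcont : ContinuousOn h (Set.Icc (-(1 / 2) : ℝ) (1 / 2)))
    (hY : ∀ t, MemLp (Y t) 2 μ) (hYh : HasSpectralDensity μ Y h)
    (hX : IsFracDiff μ (-(H - 1 / 2)) Y X) (s t : ℤ) :
    covariance (X s) (X t) μ = ∫ x in (-(1 / 2) : ℝ)..(1 / 2),
      fracSpectralDensity H h x * Real.cos (((t : ℝ) - s) * (2 * Real.pi * x)) := by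
  have hd : 0 < H - 1 / 2 := by linarith
  have hd1 : H - 1 / 2 < 1 := by linarith
  set d := H - 1 / 2 with hdef
  have hU : ∀ (s : ℤ) (N : ℕ),
      MemLp (fun w => ∑ j ∈ Finset.range N, fracDiffCoeff (-d) j * Y (s - (j : ℤ)) w) 2 μ :=
    fun s N => memLp_finsetSum _ fun j _ => (hY _).const_mul _
  have hlim := tendsto_covariance (hU s) (hU t) (hX.memLp s) (hX.memLp t) (hX.tendsto s)
    (hX.tendsto t)
  simp_rw [covariance_partial_sum hcont hY hYh] at hlim
  refine tendsto_nhds_unique hlim ?_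
  obtain ⟨C, hC⟩ := isCompact_Icc.exists_bound_of_continuousOn hcont
  have hz : ∀ x : ℝ, ‖Complex.exp ((2 * Real.pi * x : ℝ) * Complex.I)‖ = 1 :=
    fun x => Complex.norm_exp_ofReal_mul_I _
  have hz1 : ∀ x ∈ Set.Icc (-(1 / 2) : ℝ) (1 / 2), x ≠ 0 →
      Complex.exp ((2 * Real.pi * x : ℝ) * Complex.I) ≠ 1 := by
    intro x hx hx0 h1
    have := norm_one_sub_exp x
    rw [h1, sub_self, norm_zero, eq_comm, abs_eq_zero] at this
    exact sin_pi_mul_ne_zero (abs_le_half_of_mem hx) hx0 (by linarith)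
  have hexp : -(2 * d) = -(2 * H - 1) := by rw [hdef]; ring
  refine intervalIntegral.tendsto_integral_filter_of_dominated_convergence
    (fun x => C * (4 / d + 2) ^ 2 * |2 * Real.sin (Real.pi * x)| ^ (-(2 * H - 1))) ?_ ?_ ?_ ?_
  · refine Eventually.of_forall fun N => ContinuousOn.aestronglyMeasurable ?_ measurableSet_uIoc
    refine ContinuousOn.mul (hcont.mono fun x => mem_Icc_of_mem_uIoc) ?_
    fun_prop
  · refine Eventually.of_forall fun N => ?_
    filter_upwards [ae_ne_zero] with x hx0 hx
    have hx' := mem_Icc_of_mem_uIoc hx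
    have hb := norm_binomPartial_le hd hd1 (hz x) (hz1 x hx' hx0) N
    rw [norm_one_sub_exp] at hb
    have hb2 := pow_le_pow_left₀ (norm_nonneg _) hb 2
    rw [mul_pow, ← Real.rpow_mul_natCast (abs_nonneg _),
      show -d * ((2 : ℕ) : ℝ) = -(2 * H - 1) by rw [← hexp]; push_cast; ring] at hb2
    rw [norm_mul, norm_mul, norm_pow, norm_norm, mul_assoc C]
    have hc : ‖Real.cos (((t : ℝ) - s) * (2 * Real.pi * x))‖ ≤ 1 := Real.abs_cos_le_one _
    have hCx := hC x hx'
    refine mul_le_mul hCx ?_ (by positivity) ((norm_nonneg _).trans hCx)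
    exact (mul_le_of_le_one_left (by positivity) hc).trans hb2
  · exact (intervalIntegrable_abs_two_sin_rpow (by linarith) (by linarith)).const_mul _
  · filter_upwards [ae_ne_zero] with x hx0 hx
    have hx' := mem_Icc_of_mem_uIoc hx
    have := tendsto_norm_binomPartial hd hd1 (hz x) (hz1 x hx' hx0)
    rw [norm_one_sub_exp, hexp] at this
    have h2 := (this.const_mul (Real.cos (((t : ℝ) - s) * (2 * Real.pi * x)))).const_mul (h x)
    simp only [fracSpectralDensity]
    rw [show h x * |2 * Real.sin (Real.pi * x)| ^ (-(2 * H - 1))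
      * Real.cos (((t : ℝ) - s) * (2 * Real.pi * x)) = h x * (Real.cos (((t : ℝ) - s)
      * (2 * Real.pi * x)) * |2 * Real.sin (Real.pi * x)| ^ (-(2 * H - 1))) by ring]
    exact h2

end SecondOrder

/-! ### Variance time functions as integrals -/

theorem doubleSum_const_mul (c : ℝ) (a : ℤ → ℝ) (n : ℕ) :
    doubleSum (fun k => c * a k) n = c * doubleSum a n := by
  simp only [doubleSum, Finset.mul_sum]

theorem doubleSum_integral {F : ℤ → ℝ → ℝ} {a b : ℝ}
    (hF : ∀ k, IntervalIntegrable (F k) volume a b) (n : ℕ) :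
    doubleSum (fun k => ∫ x in a..b, F k x) n = ∫ x in a..b, doubleSum (fun k => F k x) n := by
  unfold doubleSum
  rw [intervalIntegral.integral_finsetSum fun i _ => intervalIntegrable_finset_sum _ hF]
  refine Finset.sum_congr rfl fun i _ => ?_
  rw [intervalIntegral.integral_finsetSum fun j _ => hF j]

/-- `∫ f(x) sin²(πnx) / sin²(πx) dx`, the variance of a sum of `n` consecutive terms of a process
with spectral density `f`. -/
noncomputable def fejerIntegral (f : ℝ → ℝ) (n : ℕ) : ℝ :=
  ∫ x in (-(1 / 2) : ℝ)..(1 / 2),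
    f x * (Real.sin (Real.pi * n * x) ^ 2 / Real.sin (Real.pi * x) ^ 2)

theorem sum_Icc_shift (f : ℤ → ℝ) (m : ℕ) (c : ℤ) :
    ∑ j ∈ Finset.Icc (c + 1) (c + m), f j = ∑ i ∈ Finset.range m, f (c + 1 + i) := by
  symm
  refine Finset.sum_bij (fun i _ => c + 1 + (i : ℤ)) ?_ ?_ ?_ ?_
  · intro i hi
    rw [Finset.mem_range] at hi
    rw [Finset.mem_Icc]; omega
  · intro i _ j _ hij
    simpa using hij
  · intro j hj
    rw [Finset.mem_Icc] at hj
    exact ⟨(j - c - 1).toNat, by rw [Finset.mem_range]; omega, by omega⟩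
  · intro i _; rfl

section SecondOrder

variable {Ω : Type*} [MeasurableSpace Ω] {μ : Measure Ω} [IsProbabilityMeasure μ]
  {f : ℝ → ℝ} {X : ℤ → Ω → ℝ}

theorem acvf_aggregate (hf : IntervalIntegrable f volume (-(1 / 2) : ℝ) (1 / 2))
    (hX : ∀ t, MemLp (X t) 2 μ)
    (hcov : ∀ s t : ℤ, covariance (X s) (X t) μ = ∫ x in (-(1 / 2) : ℝ)..(1 / 2),
      f x * Real.cos (((t : ℝ) - s) * (2 * Real.pi * x))) (m : ℕ) (k : ℤ) :
    acvf μ (aggregate X m) k = (1 / (m : ℝ)) ^ 2 * ∫ x in (-(1 / 2) : ℝ)..(1 / 2),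
      f x * (Real.cos ((m * k) * (2 * Real.pi * x))
        * ‖∑ j ∈ Finset.range m, ((1 : ℝ) : ℂ) *
            Complex.exp ((2 * Real.pi * x : ℝ) * Complex.I) ^ j‖ ^ 2) := by
  have hagg : ∀ t : ℤ, aggregate X m t = fun w => (1 / (m : ℝ)) *
      ∑ i ∈ Finset.range m, X ((m : ℤ) * (t - 1) + 1 + i) w := by
    intro t; ext w
    rw [aggregate, ← sum_Icc_shift (fun j => X j w) m ((m : ℤ) * (t - 1))]
    congr 3; ring
  rw [acvf, hagg, hagg, covariance_const_mul_left, covariance_const_mul_right,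
    covariance_fun_sum_fun_sum' (fun j _ => hX _) (fun j _ => hX _), sq, mul_assoc]
  congr 2
  simp_rw [← sum_sum_mul_cos, Finset.mul_sum]
  have hint : ∀ c : ℝ, IntervalIntegrable (fun x => f x * (1 * 1 * Real.cos (c * (2 * Real.pi * x))))
      volume (-(1 / 2) : ℝ) (1 / 2) := fun c =>
    hf.mul_continuousOn (by fun_prop)
  rw [intervalIntegral.integral_finsetSum fun (i : ℕ) _ =>
      intervalIntegrable_finset_sum _ fun j : ℕ => hint (m * k + i - j),
    -- The covariances carry the lag `mk + j - i`, the expanded square `mk + i - j`; exchanging the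
    -- two indices matches them.
    Finset.sum_comm]
  refine Finset.sum_congr rfl fun i _ => ?_
  rw [intervalIntegral.integral_finsetSum fun j _ => hint _]
  refine Finset.sum_congr rfl fun j _ => ?_
  rw [hcov]
  refine intervalIntegral.integral_congr fun x _ => ?_
  rw [one_mul, one_mul]
  congr 3
  push_cast
  ring

/-- Two Fejér kernels compose: the one of order `m` at `πx` comes from averaging, the one of order
`n` at `mπx` from the double sum, and the factor `sin²(mπx)` cancels between them. -/
theorem vtf_aggregate (hf : IntervalIntegrable f volume (-(1 / 2) : ℝ) (1 / 2))
    (hX : ∀ t, MemLp (X t) 2 μ)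
    (hcov : ∀ s t : ℤ, covariance (X s) (X t) μ = ∫ x in (-(1 / 2) : ℝ)..(1 / 2),
      f x * Real.cos (((t : ℝ) - s) * (2 * Real.pi * x))) {m : ℕ} (n : ℕ) :
    vtf μ (aggregate X m) n = (1 / (m : ℝ)) ^ 2 * fejerIntegral f (n * m) := by
  rcases Nat.eq_zero_or_pos m with rfl | hm
  · unfold vtf
    simp_rw [funext (acvf_aggregate hf hX hcov 0)]
    simp [doubleSum]
  unfold vtf
  rw [funext (acvf_aggregate hf hX hcov m), doubleSum_const_mul, doubleSum_integral]
  · congr 1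
    refine intervalIntegral.integral_congr_ae ?_
    have hsm : ∀ᵐ x : ℝ, Real.sin (m * (Real.pi * x)) ≠ 0 := by
      have : {x : ℝ | Real.sin (m * (Real.pi * x)) = 0}
          ⊆ Set.range (fun k : ℤ => (k : ℝ) / m) := by
        intro x hx
        obtain ⟨k, hk⟩ := Real.sin_eq_zero_iff.1 hx
        refine ⟨k, ?_⟩
        have hm0 : (m : ℝ) ≠ 0 := by exact_mod_cast hm.ne'
        simp only
        rw [div_eq_iff hm0]
        have : (k : ℝ) * Real.pi = (x * m) * Real.pi := by rw [hk]; ring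
        exact mul_right_cancel₀ Real.pi_ne_zero this
      rw [ae_iff]
      simp only [not_not]
      exact ((Set.countable_range _).mono this).measure_zero _
    filter_upwards [hsm, ae_ne_zero] with x hx hx0 hxm
    have hs := sin_pi_mul_ne_zero (abs_le_half_of_mem (mem_Icc_of_mem_uIoc hxm)) hx0
    have h1 := norm_sum_exp_sq_mul_sin_sq m x
    have h2 := doubleSum_cos_mul_sin_sq n (m * (Real.pi * x))
    set P := ‖∑ j ∈ Finset.range m, ((1 : ℝ) : ℂ) *
      Complex.exp ((2 * Real.pi * x : ℝ) * Complex.I) ^ j‖ ^ 2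
    have h3 : doubleSum (fun k => f x * (Real.cos ((m * k) * (2 * Real.pi * x)) * P)) n
        = f x * (P * doubleSum (fun k => Real.cos (2 * (m * (Real.pi * x)) * k)) n) := by
      rw [← doubleSum_const_mul, ← doubleSum_const_mul]
      congr 1; ext k
      rw [show (m : ℝ) * k * (2 * Real.pi * x) = 2 * (m * (Real.pi * x)) * k by ring]
      ring
    rw [h3]
    congr 1
    rw [eq_div_iff (pow_ne_zero 2 hs)]
    rw [show Real.pi * m * x = m * (Real.pi * x) by ring] at h1
    push_cast
    rw [show Real.pi * (n * m) * x = n * (m * (Real.pi * x)) by ring, ← h2, ← h1]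
    ring
  · intro k
    exact hf.mul_continuousOn (by fun_prop)

theorem vtf_eq_fejerIntegral (hf : IntervalIntegrable f volume (-(1 / 2) : ℝ) (1 / 2))
    (hX : ∀ t, MemLp (X t) 2 μ)
    (hcov : ∀ s t : ℤ, covariance (X s) (X t) μ = ∫ x in (-(1 / 2) : ℝ)..(1 / 2),
      f x * Real.cos (((t : ℝ) - s) * (2 * Real.pi * x))) (n : ℕ) :
    vtf μ X n = fejerIntegral f n := by
  have h1 : aggregate X 1 = X := by
    ext t w
    simp [aggregate]
  have := vtf_aggregate hf hX hcov (m := 1) n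
  rw [h1] at this
  simpa using this

theorem ctf_aggregate (hf : IntervalIntegrable f volume (-(1 / 2) : ℝ) (1 / 2))
    (hX : ∀ t, MemLp (X t) 2 μ)
    (hcov : ∀ s t : ℤ, covariance (X s) (X t) μ = ∫ x in (-(1 / 2) : ℝ)..(1 / 2),
      f x * Real.cos (((t : ℝ) - s) * (2 * Real.pi * x))) {m : ℕ} (hm : 1 ≤ m) (n : ℕ) :
    ctf μ (aggregate X m) n = fejerIntegral f (n * m) / fejerIntegral f m := by
  have : (1 / (m : ℝ)) ^ 2 ≠ 0 := by
    have : (0 : ℝ) < m := by exact_mod_cast hm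
    positivity
  rw [ctf, vtf_aggregate hf hX hcov, vtf_aggregate hf hX hcov, one_mul,
    mul_div_mul_left _ _ this]

end SecondOrder

/-! ### The shifted zeta series -/

/-- `∑_{k ≥ 1} (k + x)^{-b}`. -/
noncomputable def shiftZeta (b x : ℝ) : ℝ := ∑' k : ℕ, ((k : ℝ) + 1 + x) ^ (-b)

theorem summable_shiftZeta {b x : ℝ} (hb : 1 < b) (hx : -1 < x) :
    Summable fun k : ℕ => ((k : ℝ) + 1 + x) ^ (-b) := by
  refine ((Real.summable_one_div_nat_add_rpow (1 + x) b).2 hb).congr fun k => ?_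
  have : 0 < (k : ℝ) + (1 + x) := by have : (0 : ℝ) ≤ k := k.cast_nonneg
                                     linarith
  rw [abs_of_pos this, Real.rpow_neg (by linarith), one_div, add_assoc]

theorem hasDerivAt_shiftZeta {b x : ℝ} (hb : 1 < b) (hx : -1 < x) :
    HasDerivAt (shiftZeta b) (-b * shiftZeta (b + 1) x) x := by
  -- On `(c, ∞)` the differentiated terms are bounded by their values at `c`, which are summable
  -- because `c > -1`.
  obtain ⟨c, hc1, hcx⟩ := exists_between hx
  have hpos : ∀ (k : ℕ) (y : ℝ), c < y → 0 < (k : ℝ) + 1 + c ∧ (k : ℝ) + 1 + c < k + 1 + y := by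
    intro k y hy
    have : (0 : ℝ) ≤ k := k.cast_nonneg
    constructor <;> linarith
  have := hasDerivAt_tsum_of_isPreconnected (t := Set.Ioi c) (y := x) (y₀ := x)
    (g := fun (k : ℕ) y => ((k : ℝ) + 1 + y) ^ (-b))
    (g' := fun (k : ℕ) y => -b * ((k : ℝ) + 1 + y) ^ (-(b + 1)))
    (u := fun k : ℕ => b * ((k : ℝ) + 1 + c) ^ (-(b + 1)))
    ((summable_shiftZeta (by linarith) hc1).mul_left b) isOpen_Ioi isPreconnected_Ioi
    (fun k y hy => by
      have h1 := hpos k y hy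
      have h2 : HasDerivAt (fun y => (k : ℝ) + 1 + y) 1 y := (hasDerivAt_id y).const_add _
      have := h2.rpow_const (p := -b) (Or.inl (by linarith))
      refine this.congr_deriv ?_
      rw [show -b - 1 = -(b + 1) by ring]; ring)
    (fun k y hy => by
      have h1 := hpos k y hy
      have hy' : 0 < (k : ℝ) + 1 + y := by linarith
      rw [norm_mul, Real.norm_of_nonneg (Real.rpow_nonneg hy'.le _), norm_neg,
        Real.norm_of_nonneg (by linarith)]
      exact mul_le_mul_of_nonneg_left
        (Real.rpow_le_rpow_of_nonpos h1.1 h1.2.le (by linarith)) (by linarith))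
    hcx (summable_shiftZeta hb hx) hcx
  rw [tsum_mul_left] at this
  exact this

/-- Differentiation only raises the exponent `b` by one, so the induction on smoothness runs over
all `b > 1` at once. -/
theorem contDiffOn_shiftZeta (n : ℕ) {b : ℝ} (hb : 1 < b) :
    ContDiffOn ℝ n (shiftZeta b) (Set.Ioi (-1)) := by
  induction n generalizing b with
  | zero =>
    exact contDiffOn_zero.2 fun x hx =>
      (hasDerivAt_shiftZeta hb hx).continuousAt.continuousWithinAt
  | succ n ih =>
    push_cast
    rw [contDiffOn_succ_iff_deriv_of_isOpen isOpen_Ioi]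
    refine ⟨fun x hx => (hasDerivAt_shiftZeta hb hx).differentiableAt.differentiableWithinAt,
      by simp, ?_⟩
    refine ((contDiffOn_const (c := -b)).mul (ih (b := b + 1) (by linarith))).congr fun x hx => ?_
    exact (hasDerivAt_shiftZeta hb hx).deriv

theorem shiftZeta_nonneg (b : ℝ) {x : ℝ} (hx : -1 < x) : 0 ≤ shiftZeta b x :=
  tsum_nonneg fun k => Real.rpow_nonneg (by have : (0 : ℝ) ≤ k := k.cast_nonneg
                                            linarith) _

/-- The part `∑_{k ≠ 0} |k + x|^{-(2H+1)}` of the periodised kernel that is regular at `0`. -/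
noncomputable def regKernel (H x : ℝ) : ℝ := shiftZeta (2 * H + 1) x + shiftZeta (2 * H + 1) (-x)

theorem regKernel_neg (H x : ℝ) : regKernel H (-x) = regKernel H x := by
  unfold regKernel; rw [neg_neg, add_comm]

theorem regKernel_nonneg (H : ℝ) {x : ℝ} (hx : |x| < 1) : 0 ≤ regKernel H x :=
  add_nonneg (shiftZeta_nonneg _ (abs_lt.1 hx).1)
    (shiftZeta_nonneg _ (by linarith [(abs_lt.1 hx).2]))

theorem contDiffOn_regKernel (n : ℕ) {H : ℝ} (hH : 0 < H) :
    ContDiffOn ℝ n (regKernel H) (Set.Ioo (-1) 1) := by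
  have h := contDiffOn_shiftZeta n (b := 2 * H + 1) (by linarith)
  refine (h.mono fun x hx => hx.1).add (h.comp contDiff_neg.contDiffOn fun x hx => ?_)
  simp only [Set.mem_Ioi]
  linarith [hx.2]

/-- The term `k = 0` is split off, and the positive and negative `k` give the two shifted zeta
series. At `x = 0` the singular term is `0` on both sides, by the convention for `0` to a nonzero
power. -/
theorem powKernel_eq {H : ℝ} (hH : 0 < H) {x : ℝ} (hx : |x| < 1) :
    powKernel H x = |x| ^ (-(2 * H + 1)) + regKernel H x := by
  obtain ⟨h1, h2⟩ := abs_lt.1 hx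
  have hb : 1 < 2 * H + 1 := by linarith
  have s1 := (summable_shiftZeta hb h1).hasSum
  have s2 := (summable_shiftZeta hb (show -1 < -x by linarith)).hasSum
  have e1 : ∀ k : ℕ, |((k + 1 : ℕ) : ℤ) + x| = (k : ℝ) + 1 + x := by
    intro k
    have : (0 : ℝ) ≤ k := k.cast_nonneg
    push_cast
    exact abs_of_pos (by linarith)
  have e2 : ∀ k : ℕ, |((-((k : ℤ) + 1) : ℤ) : ℝ) + x| = (k : ℝ) + 1 + -x := by
    intro k
    have : (0 : ℝ) ≤ k := k.cast_nonneg
    push_cast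
    rw [abs_of_neg (by linarith)]; ring
  have s1' : HasSum (fun k : ℕ => |((k : ℤ) : ℝ) + x| ^ (-(2 * H + 1)))
      (|x| ^ (-(2 * H + 1)) + shiftZeta (2 * H + 1) x) := by
    rw [← hasSum_nat_add_iff' 1]
    simp only [e1, Finset.range_one, Finset.sum_singleton]
    simpa [shiftZeta] using s1
  have s2' : HasSum (fun k : ℕ => |((-((k : ℤ) + 1) : ℤ) : ℝ) + x| ^ (-(2 * H + 1)))
      (shiftZeta (2 * H + 1) (-x)) := by
    simp only [e2]; exact s2
  have := HasSum.of_nat_of_neg_add_one (f := fun k : ℤ => |(k : ℝ) + x| ^ (-(2 * H + 1))) s1' s2'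
  rw [powKernel, this.tsum_eq, regKernel, add_assoc]

/-! ### Regularity of the ratio of the spectral densities -/

theorem contDiff_sinc {n : WithTop ℕ∞} : ContDiff ℝ n Real.sinc := by
  have hsin : ∀ x, AnalyticAt ℝ Real.sin x := fun x =>
    (Real.contDiff_sin (n := ⊤)).contDiffAt.analyticAt
  refine ContDiff.of_le (n := ⊤) ?_ le_top
  rw [contDiff_iff_contDiffAt]
  intro x
  refine AnalyticAt.contDiffAt ?_
  rcases eq_or_ne x 0 with rfl | hx
  -- At the origin `sinc` is the slope of `sin` at `0`, whose power series is that of `sin` shifted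
  -- by one.
  · obtain ⟨p, hp⟩ := hsin 0
    rw [Real.sinc_eq_dslope]
    exact ⟨_, hp.has_fpower_series_dslope_fslope⟩
  · refine ((hsin x).div analyticAt_id hx).congr ?_
    filter_upwards [isOpen_ne.mem_nhds hx] with y hy
    simp [Real.sinc_of_ne_zero hy]

theorem sinc_pi_mul_pos {x : ℝ} (hx : |x| < 1) : 0 < Real.sinc (Real.pi * x) := by
  rcases eq_or_ne x 0 with rfl | h0
  · simp
  have key : ∀ y : ℝ, 0 < y → y < 1 → 0 < Real.sinc (Real.pi * y) := by
    intro y h0 h1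
    have hp : 0 < Real.pi * y := by positivity
    rw [Real.sinc_of_ne_zero hp.ne']
    exact div_pos (Real.sin_pos_of_pos_of_lt_pi hp (by nlinarith [Real.pi_pos])) hp
  rcases abs_cases x with ⟨h, _⟩ | ⟨h, _⟩
  · rw [h] at hx; exact key x (lt_of_le_of_ne ‹_› h0.symm) hx
  · rw [h] at hx
    have := key (-x) (by linarith) hx
    rwa [mul_neg, Real.sinc_neg] at this

/-- The factor `sinc(πx)^{-(2H+1)}` of the spectral ratio. -/
noncomputable def sincWeight (H x : ℝ) : ℝ := Real.sinc (Real.pi * x) ^ (-(2 * H + 1))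

theorem sincWeight_neg (H x : ℝ) : sincWeight H (-x) = sincWeight H x := by
  simp [sincWeight]

theorem sincWeight_zero (H : ℝ) : sincWeight H 0 = 1 := by simp [sincWeight]

theorem contDiffOn_sincWeight (H : ℝ) {n : WithTop ℕ∞} :
    ContDiffOn ℝ n (sincWeight H) (Set.Ioo (-1) 1) := by
  refine ContDiffOn.rpow_const_of_ne ?_ fun x hx => (sinc_pi_mul_pos (abs_lt.2 hx)).ne'
  exact (contDiff_sinc.comp (contDiff_const.mul contDiff_id)).contDiffOn

theorem fgnSpectralDensity_eq (H c x : ℝ) :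
    fgnSpectralDensity H c x = c * (Real.pi ^ 2)⁻¹ * Real.sin (Real.pi * x) ^ 2 * powKernel H x := by
  have hp : 0 < 2 * Real.pi := by positivity
  have : ∀ j : ℤ, |2 * Real.pi * (j : ℝ) + 2 * Real.pi * x| ^ (-(2 * H + 1))
      = (2 * Real.pi) ^ (-(2 * H + 1)) * |(j : ℝ) + x| ^ (-(2 * H + 1)) := by
    intro j
    rw [← mul_add, abs_mul, abs_of_pos hp, Real.mul_rpow hp.le (abs_nonneg _)]
  unfold fgnSpectralDensity powKernel
  simp_rw [this]
  rw [tsum_mul_left, Real.rpow_neg hp.le]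
  have := (Real.rpow_pos_of_pos hp (2 * H + 1)).ne'
  field_simp

theorem powKernel_eq_mul {H : ℝ} (hH : 0 < H) {x : ℝ} (hx : |x| < 1) (hx0 : x ≠ 0) :
    powKernel H x = |x| ^ (-(2 * H + 1)) * (1 + |x| ^ (2 * H + 1) * regKernel H x) := by
  rw [powKernel_eq hH hx, mul_add, mul_one, ← mul_assoc, ← Real.rpow_add (abs_pos.2 hx0)]
  simp

theorem one_add_regKernel_pos (H : ℝ) {x : ℝ} (hx : |x| < 1) :
    0 < 1 + |x| ^ (2 * H + 1) * regKernel H x := by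
  have := regKernel_nonneg H hx
  positivity

theorem powKernel_pos {H : ℝ} (hH : 0 < H) {x : ℝ} (hx : |x| < 1) (hx0 : x ≠ 0) :
    0 < powKernel H x := by
  rw [powKernel_eq_mul hH hx hx0]
  have := one_add_regKernel_pos H hx
  have := abs_pos.2 hx0
  positivity

theorem fracPrefactor_pos {H : ℝ} {h : ℝ → ℝ} (h0 : 0 < h 0) : 0 < fracPrefactor H h := by
  unfold fracPrefactor; positivity

/-- The singularities of the two densities at the origin cancel. What remains is a factor as smooth
as `h`, times a correction whose only non-smooth ingredient is `|x|^{2H+1}`; both the bound `g - 1 =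
O(x²)` and the decay of the `G_j` rest on this form. -/
theorem spectralRatio_eq {H : ℝ} (hH : 0 < H) {h : ℝ → ℝ} (h0 : 0 < h 0) {x : ℝ}
    (hx : |x| ≤ 1 / 2) : spectralRatio H h x
      = h x / h 0 * sincWeight H x * (1 + |x| ^ (2 * H + 1) * regKernel H x)⁻¹ := by
  unfold spectralRatio
  split_ifs with hx0
  · subst hx0
    rw [sincWeight_zero, abs_zero, Real.zero_rpow (by linarith)]
    simp [h0.ne']
  have hx1 : |x| < 1 := by linarith
  have hxp := abs_pos.2 hx0
  have hs := abs_pos.2 (sin_pi_mul_ne_zero hx hx0)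
  have hR := one_add_regKernel_pos H hx1
  have hpi := Real.pi_pos
  rw [fgnSpectralDensity_eq, powKernel_eq_mul hH hx1 hx0, fracSpectralDensity, fracPrefactor,
    sincWeight]
  have hsinc : Real.sinc (Real.pi * x) = |Real.sin (Real.pi * x)| / (Real.pi * |x|) := by
    rw [← abs_of_pos (sinc_pi_mul_pos hx1), Real.sinc_of_ne_zero (mul_ne_zero hpi.ne' hx0),
      abs_div, abs_mul, abs_of_pos hpi]
  rw [hsinc, Real.div_rpow hs.le (by positivity), Real.mul_rpow hpi.le hxp.le, abs_mul, abs_two,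
    Real.mul_rpow (by norm_num) hs.le, Real.mul_rpow (by norm_num) hpi.le,
    ← sq_abs (Real.sin (Real.pi * x)),
    show -(2 * H - 1) = 2 + -(2 * H + 1) by ring, Real.rpow_add hs, Real.rpow_two,
    show 1 - 2 * H = 2 + -(2 * H + 1) by ring, Real.rpow_add hpi, Real.rpow_two]
  have p1 := (Real.rpow_pos_of_pos (show (0 : ℝ) < 2 by norm_num) (2 + -(2 * H + 1))).ne'
  have p2 := (Real.rpow_pos_of_pos hs (-(2 * H + 1))).ne'
  have p3 := (Real.rpow_pos_of_pos hpi (-(2 * H + 1))).ne'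
  have p4 := (Real.rpow_pos_of_pos hxp (-(2 * H + 1))).ne'
  field_simp

/-- Evenness gives `φ'(0) = 0`, differentiability of `φ'` gives `φ' = O(x)`, and the mean value
inequality gives the square. -/
theorem exists_sq_bound_of_even {φ : ℝ → ℝ} {r : ℝ} (hr : 0 < r)
    (hφ : ContDiffOn ℝ 2 φ (Set.Ioo (-r) r)) (heven : ∀ x, φ (-x) = φ x) :
    ∃ C, ∃ ρ > 0, ∀ x, |x| ≤ ρ → |φ x - φ 0| ≤ C * x ^ 2 := by
  have h0 : (0 : ℝ) ∈ Set.Ioo (-r) r := ⟨by linarith, hr⟩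
  have h2 := (contDiffOn_succ_iff_deriv_of_isOpen (n := 1) isOpen_Ioo).1 hφ
  have hd0 : deriv φ 0 = 0 := by
    have := deriv_comp_neg (f := φ) (x := (0 : ℝ))
    rw [funext heven, neg_zero] at this
    change deriv φ 0 = - deriv φ 0 at this
    linarith
  have hdd : DifferentiableAt ℝ (deriv φ) 0 :=
    ((h2.2.2.differentiableOn (by norm_num)).differentiableAt (isOpen_Ioo.mem_nhds h0))
  obtain ⟨C, hC⟩ := hdd.hasDerivAt.isBigO_sub.bound
  obtain ⟨ε, hε, hball⟩ := Metric.eventually_nhds_iff_ball.1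
    (hC.and (isOpen_Ioo.mem_nhds h0))
  refine ⟨C, ε / 2, by positivity, fun x hx => ?_⟩
  have hsub : ∀ y ∈ Metric.closedBall (0 : ℝ) |x|, y ∈ Metric.ball (0 : ℝ) ε ∧ |y| ≤ |x| := by
    intro y hy
    have hy' : |y| ≤ |x| := by simpa using hy
    exact ⟨by simpa using (by linarith : |y| < ε), hy'⟩
  -- The constant of the `O`-bound has no prescribed sign; the bound at a nonzero `x` forces it to
  -- be nonnegative.
  have hC0 : 0 ≤ C ∨ x = 0 := by
    by_cases hx0 : x = 0
    · exact Or.inr hx0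
    · left
      have := (hball x (hsub x (by simp)).1).1
      simp only [sub_zero, Real.norm_eq_abs] at this
      by_contra hneg
      have := (abs_nonneg _).trans this
      nlinarith [abs_pos.2 hx0]
  rcases hC0 with hC0 | rfl
  swap; · simp
  have := (convex_closedBall (0 : ℝ) |x|).norm_image_sub_le_of_norm_deriv_le (f := φ) (C := C * |x|)
    (x := 0) (y := x)
    (fun y hy => (h2.1 y (hball y (hsub y hy).1).2).differentiableAt
      (isOpen_Ioo.mem_nhds (hball y (hsub y hy).1).2))
    (fun y hy => by
      have h3 := (hball y (hsub y hy).1).1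
      rw [hd0, sub_zero, sub_zero] at h3
      exact h3.trans (mul_le_mul_of_nonneg_left (hsub y hy).2 hC0))
    (by simp) (by simp)
  rw [sub_zero, Real.norm_eq_abs, Real.norm_eq_abs, mul_assoc, abs_mul_abs_self, ← sq] at this
  exact this

section Ratio

variable {H : ℝ} {h : ℝ → ℝ}

theorem spectralRatio_neg (heven : ∀ x, h (-x) = h x) {x : ℝ} (hH : 0 < H) (h0 : 0 < h 0)
    (hx : |x| ≤ 1 / 2) : spectralRatio H h (-x) = spectralRatio H h x := by
  rw [spectralRatio_eq hH h0 hx, spectralRatio_eq hH h0 (by rwa [abs_neg]), heven,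
    sincWeight_neg, regKernel_neg, abs_neg]

theorem Icc_half_subset : Set.Icc (-(1 / 2) : ℝ) (1 / 2) ⊆ Set.Ioo (-1) 1 := fun x hx =>
  ⟨by linarith [hx.1], by linarith [hx.2]⟩

theorem continuousOn_regKernel (hH : 0 < H) :
    ContinuousOn (regKernel H) (Set.Icc (-(1 / 2) : ℝ) (1 / 2)) :=
  (contDiffOn_regKernel 0 hH).continuousOn.mono Icc_half_subset

theorem continuousOn_spectralRatio (hH : 0 < H) (h0 : 0 < h 0)
    (hcont : ContinuousOn h (Set.Icc (-(1 / 2) : ℝ) (1 / 2))) :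
    ContinuousOn (spectralRatio H h) (Set.Icc (-(1 / 2) : ℝ) (1 / 2)) := by
  refine ContinuousOn.congr (f := fun x => h x / h 0 * sincWeight H x *
    (1 + |x| ^ (2 * H + 1) * regKernel H x)⁻¹) ?_
    fun x hx => spectralRatio_eq hH h0 (abs_le_half_of_mem hx)
  have hw : ContinuousOn (sincWeight H) (Set.Icc (-(1 / 2) : ℝ) (1 / 2)) :=
    (contDiffOn_sincWeight H (n := 0)).continuousOn.mono Icc_half_subset
  have hp : Continuous fun x : ℝ => |x| ^ (2 * H + 1) :=
    continuous_abs.rpow_const fun x => Or.inr (by linarith)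
  refine ((hcont.div_const _).mul hw).mul (ContinuousOn.inv₀ ?_ fun x hx => ?_)
  · exact continuousOn_const.add (hp.continuousOn.mul (continuousOn_regKernel hH))
  · exact (one_add_regKernel_pos H (by linarith [abs_le_half_of_mem hx])).ne'

/-- Near `0` the smooth even factor is quadratically close to 1 and the correction is at most a
multiple of `|x|^{2H+1} ≤ x²`, as `H > 1/2`. Away from `0` boundedness is enough. -/
theorem exists_spectralRatio_sub_one_le (hH : 1 / 2 < H) (h0 : 0 < h 0)
    (hcont : ContinuousOn h (Set.Icc (-(1 / 2) : ℝ) (1 / 2)))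
    (hdiff : ContDiffOn ℝ 2 h (Set.Ioo (-(1 / 2) : ℝ) (1 / 2))) (heven : ∀ x, h (-x) = h x) :
    ∃ C, ∀ x, |x| ≤ 1 / 2 → |spectralRatio H h x - 1| ≤ C * x ^ 2 := by
  have hH0 : 0 < H := by linarith
  obtain ⟨C₁, ρ, hρ, h1⟩ := exists_sq_bound_of_even (φ := fun x => h x / h 0 * sincWeight H x)
    (r := 1 / 2) (by norm_num)
    ((hdiff.div_const _).mul ((contDiffOn_sincWeight H).mono
      (Set.Ioo_subset_Ioo (by norm_num) (by norm_num))))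
    (fun x => by rw [heven, sincWeight_neg])
  simp only [div_self h0.ne', sincWeight_zero, mul_one] at h1
  obtain ⟨C₂, h2⟩ := isCompact_Icc.exists_bound_of_continuousOn (continuousOn_regKernel hH0)
  obtain ⟨C₃, h3⟩ := isCompact_Icc.exists_bound_of_continuousOn
    (continuousOn_spectralRatio hH0 h0 hcont)
  have hC2 : 0 ≤ C₂ := (norm_nonneg _).trans (h2 0 (by norm_num))
  have hC3 : 0 ≤ C₃ := (norm_nonneg _).trans (h3 0 (by norm_num))
  have hC1 : 0 ≤ C₁ := by
    have := (abs_nonneg _).trans (h1 ρ (abs_of_pos hρ).le)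
    by_contra hneg
    nlinarith [sq_pos_of_pos hρ]
  refine ⟨max (C₁ + C₂) ((C₃ + 1) / ρ ^ 2), fun x hx => ?_⟩
  have hxm : x ∈ Set.Icc (-(1 / 2) : ℝ) (1 / 2) := abs_le.1 hx
  rcases le_total |x| ρ with hxρ | hxρ
  · refine le_trans ?_ (mul_le_mul_of_nonneg_right (le_max_left _ _) (sq_nonneg x))
    have hR := one_add_regKernel_pos H (show |x| < 1 by linarith)
    have hR0 := regKernel_nonneg H (show |x| < 1 by linarith)
    have hp : |x| ^ (2 * H + 1) * regKernel H x ≤ C₂ * x ^ 2 := by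
      have e1 : |x| ^ (2 * H + 1) ≤ x ^ 2 := by
        rw [← sq_abs, ← Real.rpow_two]
        exact Real.rpow_le_rpow_of_exponent_ge' (abs_nonneg x) (by linarith) (by norm_num)
          (by linarith)
      have e2 := (Real.norm_of_nonneg hR0) ▸ h2 x hxm
      rw [mul_comm C₂]
      exact mul_le_mul e1 e2 hR0 (sq_nonneg x)
    have hp0 : 0 ≤ |x| ^ (2 * H + 1) * regKernel H x := by positivity
    -- Over a common denominator, which is at least 1 and can be dropped.
    rw [spectralRatio_eq hH0 h0 hx, ← div_eq_mul_inv, div_sub_one hR.ne', abs_div, abs_of_pos hR]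
    refine (div_le_self (abs_nonneg _) (by linarith)).trans ?_
    rw [← sub_sub, add_mul]
    refine (abs_sub _ _).trans (add_le_add (h1 x hxρ) ?_)
    rwa [abs_of_nonneg hp0]
  · refine le_trans ?_ (mul_le_mul_of_nonneg_right (le_max_right _ _) (sq_nonneg x))
    have e1 : |spectralRatio H h x - 1| ≤ C₃ + 1 :=
      (abs_sub _ _).trans (by rw [abs_one]; exact add_le_add_left (h3 x hxm) 1)
    have e2 : ρ ^ 2 ≤ x ^ 2 := by rw [← sq_abs x]; exact pow_le_pow_left₀ hρ.le hxρ 2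
    refine e1.trans ?_
    rw [div_mul_eq_mul_div, le_div_iff₀ (by positivity)]
    exact mul_le_mul_of_nonneg_left e2 (by linarith)

/-- This trades the density divided by `sin²` for the fGn kernel times `g`, so that `g = 1` is the
exactly solvable case. -/
theorem fracSpectralDensity_eq_mul (hH : 0 < H) (h0 : 0 < h 0) {x : ℝ} (hx : |x| ≤ 1 / 2)
    (hx0 : x ≠ 0) (y : ℝ) :
    fracSpectralDensity H h x * (y / Real.sin (Real.pi * x) ^ 2)
      = fracPrefactor H h * (Real.pi ^ 2)⁻¹ * (powKernel H x * y * spectralRatio H h x) := by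
  have hs := sin_pi_mul_ne_zero hx hx0
  have hK := (powKernel_pos hH (show |x| < 1 by linarith) hx0).ne'
  have hc := (fracPrefactor_pos (H := H) h0).ne'
  rw [spectralRatio, if_neg hx0, fgnSpectralDensity_eq]
  field_simp

end Ratio

/-! ### The additive constant -/

/-- The Riemann-Lebesgue lemma for cosine coefficients. -/
theorem tendsto_integral_mul_cos {F : ℝ → ℝ} {a b : ℝ} (hab : a ≤ b)
    (hF : IntervalIntegrable F volume a b) :
    Tendsto (fun n : ℕ => ∫ x in a..b, F x * Real.cos (2 * Real.pi * n * x)) atTop (𝓝 0) := by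
  have hint : Integrable ((Set.Ioc a b).indicator F) :=
    ((intervalIntegrable_iff_integrableOn_Ioc_of_le hab).1 hF).integrable_indicator
      measurableSet_Ioc
  have hlim := (Real.tendsto_integral_exp_smul_cocompact
    (fun x => (((Set.Ioc a b).indicator F x : ℝ) : ℂ))).comp
    (tendsto_natCast_atTop_atTop.mono_right (atTop_le_cocompact (α := ℝ)))
  have hre := (Complex.continuous_re.tendsto _).comp hlim
  rw [Complex.zero_re] at hre
  refine hre.congr fun n => ?_
  simp only [Function.comp]
  have hexp : ∀ x : ℝ, Real.fourierChar (-(x * n)) • (((Set.Ioc a b).indicator F x : ℝ) : ℂ)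
      = Complex.exp ((-(2 * Real.pi * n * x) : ℝ) * Complex.I)
        * (((Set.Ioc a b).indicator F x : ℝ) : ℂ) := by
    intro x
    rw [Circle.smul_def, Real.fourierChar_apply, smul_eq_mul]
    congr 4; ring
  have hi : Integrable fun x : ℝ => Complex.exp ((-(2 * Real.pi * n * x) : ℝ) * Complex.I)
      * (((Set.Ioc a b).indicator F x : ℝ) : ℂ) := by
    refine hint.ofReal.bdd_mul (c := 1) (Continuous.aestronglyMeasurable (by fun_prop)) ?_
    exact ae_of_all _ fun x => (Complex.norm_exp_ofReal_mul_I _).le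
  simp_rw [hexp]
  have hr := Complex.reCLM.integral_comp_comm hi
  simp only [Complex.reCLM_apply] at hr
  rw [← hr, intervalIntegral.integral_of_le hab, ← integral_indicator measurableSet_Ioc]
  congr 1; ext x
  rw [Complex.re_mul_ofReal, Complex.exp_ofReal_mul_I_re, Real.cos_neg]
  by_cases hx : x ∈ Set.Ioc a b
  · simp [hx, mul_comm]
  · simp [hx]

/-- The kernel is of order `|x|^{-(2H+1)}` and `g - 1` of order `x²`; their product `|x|^{1-2H}` is
integrable since `H < 1`. -/
theorem intervalIntegrable_powKernel_mul_sub {H : ℝ} (hH : 0 < H) (hH1 : H < 1) {g : ℝ → ℝ}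
    (hcont : ContinuousOn g (Set.Icc (-(1 / 2) : ℝ) (1 / 2))) {C : ℝ}
    (hg : ∀ x, |x| ≤ 1 / 2 → |g x - 1| ≤ C * x ^ 2) :
    IntervalIntegrable (fun x => powKernel H x * (g x - 1)) volume (-(1 / 2) : ℝ) (1 / 2) := by
  obtain ⟨B, hB⟩ := isCompact_Icc.exists_bound_of_continuousOn (continuousOn_regKernel hH)
  have hB0 : 0 ≤ B := (norm_nonneg _).trans (hB 0 (by norm_num))
  have hsub : Set.uIoc (-(1 / 2) : ℝ) (1 / 2) ⊆ Set.Icc (-(1 / 2) : ℝ) (1 / 2) :=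
    fun x => mem_Icc_of_mem_uIoc
  have hm : AEStronglyMeasurable (fun x => powKernel H x * (g x - 1))
      (volume.restrict (Set.uIoc (-(1 / 2) : ℝ) (1 / 2))) := by
    have h1 : AEStronglyMeasurable
        (fun x => (|x| ^ (-(2 * H + 1)) + regKernel H x) * (g x - 1))
        (volume.restrict (Set.uIoc (-(1 / 2) : ℝ) (1 / 2))) :=
      (AEStronglyMeasurable.add (Measurable.aestronglyMeasurable (by fun_prop))
        (((continuousOn_regKernel hH).mono hsub).aestronglyMeasurable measurableSet_uIoc)).mul
        (((hcont.mono hsub).sub continuousOn_const).aestronglyMeasurable measurableSet_uIoc)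
    refine h1.congr ?_
    filter_upwards [ae_restrict_mem measurableSet_uIoc] with x hx
    rw [powKernel_eq hH (by linarith [abs_le_half_of_mem (hsub hx)])]
  refine ((intervalIntegrable_abs_rpow (r := 1 - 2 * H) (by linarith) _ _).const_mul
    ((1 + B) * C)).mono_fun' hm ?_
  filter_upwards [ae_restrict_mem measurableSet_uIoc, ae_restrict_of_ae ae_ne_zero] with x hx hx0
  have hx' := abs_le_half_of_mem (hsub hx)
  have hx1 : |x| < 1 := by linarith
  have hp := abs_pos.2 hx0
  rw [norm_mul, Real.norm_of_nonneg (powKernel_pos hH hx1 hx0).le, powKernel_eq_mul hH hx1 hx0]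
  have h1 : 1 + |x| ^ (2 * H + 1) * regKernel H x ≤ 1 + B := by
    have e1 : |x| ^ (2 * H + 1) ≤ 1 := Real.rpow_le_one hp.le hx1.le (by linarith)
    have e2 := hB x (hsub hx)
    rw [Real.norm_of_nonneg (regKernel_nonneg H hx1)] at e2
    have := mul_le_mul e1 e2 (regKernel_nonneg H hx1) zero_le_one
    linarith
  calc |x| ^ (-(2 * H + 1)) * (1 + |x| ^ (2 * H + 1) * regKernel H x) * ‖g x - 1‖
      ≤ |x| ^ (-(2 * H + 1)) * (1 + B) * (C * x ^ 2) := by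
        gcongr; exact hg x hx'
    _ = (1 + B) * C * |x| ^ (1 - 2 * H) := by
        rw [show 1 - 2 * H = -(2 * H + 1) + 2 by ring, Real.rpow_add hp, Real.rpow_two, sq_abs]
        ring

/-- The additive constant between the variance time functions, relative to the variance. -/
noncomputable def additiveConst (H : ℝ) (g : ℝ → ℝ) : ℝ :=
  (∫ x in (-(1 / 2) : ℝ)..(1 / 2), powKernel H x * (g x - 1)) / (2 * fgnIntegral H)

theorem integral_powKernel_mul_sin_sq' {H : ℝ} (h0 : 0 < H) (h1 : H < 1) (j : ℕ) :
    ∫ x in (-(1 / 2) : ℝ)..(1 / 2), powKernel H x * Real.sin (Real.pi * j * x) ^ 2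
      = fgnIntegral H * (j : ℝ) ^ (2 * H) := by
  rcases Nat.eq_zero_or_pos j with rfl | hj
  · simp [Real.zero_rpow (show 2 * H ≠ 0 by linarith)]
  · exact integral_powKernel_mul_sin_sq h0 h1 hj

theorem tendsto_fejerIntegral_sub {H : ℝ} (hH : 0 < H) (hH1 : H < 1) {h : ℝ → ℝ}
    (h0 : 0 < h 0)
    (hcont : ContinuousOn (spectralRatio H h) (Set.Icc (-(1 / 2) : ℝ) (1 / 2))) {C : ℝ}
    (hg : ∀ x, |x| ≤ 1 / 2 → |spectralRatio H h x - 1| ≤ C * x ^ 2) :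
    Tendsto (fun n : ℕ => fejerIntegral (fracSpectralDensity H h) n
        - fgnVTF H (fgnVariance H (fracPrefactor H h)) n) atTop
      (𝓝 (fgnVariance H (fracPrefactor H h) * additiveConst H (spectralRatio H h))) := by
  set g := spectralRatio H h with hgdef
  set κ := fracPrefactor H h * (Real.pi ^ 2)⁻¹
  have hR := intervalIntegrable_powKernel_mul_sub hH hH1 hcont hg
  have hI := fgnIntegral_pos hH hH1
  have hRL := tendsto_integral_mul_cos (by norm_num) hR
  -- Write `g = 1 + (g - 1)` and `sin² = (1 - cos) / 2` in the second part only, as the kernel alone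
  -- is not integrable. The fGn term cancels exactly, and the cosine term is left to the
  -- Riemann-Lebesgue lemma.
  have hω : ∀ n : ℕ, fejerIntegral (fracSpectralDensity H h) n
      - fgnVTF H (fgnVariance H (fracPrefactor H h)) n
      = κ * (1 / 2 * (∫ x in (-(1 / 2) : ℝ)..(1 / 2), powKernel H x * (g x - 1))
        - 1 / 2 * ∫ x in (-(1 / 2) : ℝ)..(1 / 2), powKernel H x * (g x - 1)
            * Real.cos (2 * Real.pi * n * x)) := by
    intro n
    have hRc : IntervalIntegrable (fun x => powKernel H x * (g x - 1)
        * Real.cos (2 * Real.pi * n * x)) volume (-(1 / 2) : ℝ) (1 / 2) :=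
      hR.mul_continuousOn (by fun_prop)
    have e1 : fejerIntegral (fracSpectralDensity H h) n
        = ∫ x in (-(1 / 2) : ℝ)..(1 / 2), κ * (powKernel H x * Real.sin (Real.pi * n * x) ^ 2
          + (1 / 2 * (powKernel H x * (g x - 1)) - 1 / 2 * (powKernel H x * (g x - 1)
            * Real.cos (2 * Real.pi * n * x)))) := by
      unfold fejerIntegral
      refine intervalIntegral.integral_congr_ae ?_
      filter_upwards [ae_ne_zero] with x hx0 hx
      rw [fracSpectralDensity_eq_mul hH h0 (abs_le_half_of_mem (mem_Icc_of_mem_uIoc hx)) hx0,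
        Real.sin_sq_eq_half_sub, show 2 * (Real.pi * n * x) = 2 * Real.pi * n * x by ring]
      ring
    rw [e1, intervalIntegral.integral_const_mul, intervalIntegral.integral_add
      (intervalIntegrable_powKernel_mul_sin_sq hH hH1 n)
      ((hR.const_mul _).sub (hRc.const_mul _)), intervalIntegral.integral_sub
      (hR.const_mul _) (hRc.const_mul _), intervalIntegral.integral_const_mul,
      intervalIntegral.integral_const_mul, integral_powKernel_mul_sin_sq' hH hH1, fgnVTF,
      fgnVariance_eq hH hH1]
    ring
  simp_rw [hω]
  have := ((hRL.const_mul (1 / 2)).const_sub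
    (1 / 2 * ∫ x in (-(1 / 2) : ℝ)..(1 / 2), powKernel H x * (g x - 1))).const_mul κ
  convert this using 2
  rw [fgnVariance_eq hH hH1, additiveConst, mul_zero, sub_zero]
  simp only [κ]
  field_simp

/-! ### Correlation time functions under aggregation -/

theorem aggregation_asymptotics {ω : ℕ → ℝ} {V D H : ℝ} (hV : 0 < V) (hH : 0 < H)
    (hω : Tendsto (fun n : ℕ => ω n - V * (n : ℝ) ^ (2 * H)) atTop (𝓝 (V * D)))
    {n : ℕ} (hn : 1 ≤ n) :
    (fun m : ℕ => ω (n * m) / ω m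
      - ((n : ℝ) ^ (2 * H) + D * (1 - (n : ℝ) ^ (2 * H)) * (m : ℝ) ^ (-(2 * H))))
      =o[atTop] (fun m : ℕ => (m : ℝ) ^ (-(2 * H))) := by
  have hM : Tendsto (fun m : ℕ => (m : ℝ) ^ (2 * H)) atTop atTop :=
    (tendsto_rpow_atTop (by linarith)).comp tendsto_natCast_atTop_atTop
  have hMi := hM.inv_tendsto_atTop
  have hω' : Tendsto (fun m : ℕ => ω (n * m) - V * ((n * m : ℕ) : ℝ) ^ (2 * H)) atTop
      (𝓝 (V * D)) := hω.comp (tendsto_id.const_mul_atTop' hn)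
  -- The sequence is `q = ω(m) m^{-2H}`, written so that its limit is visible. Multiplying the error
  -- by `m^{2H}` gives a quotient with denominator `q` and with the next expression as numerator,
  -- which tends to `0`.
  have hq : Tendsto (fun m : ℕ => V + (ω m - V * (m : ℝ) ^ (2 * H)) * ((m : ℝ) ^ (2 * H))⁻¹) atTop
      (𝓝 V) := by
    simpa using (hω.mul hMi).const_add V
  have hnum := (hω'.sub (hω.const_mul ((n : ℝ) ^ (2 * H)))).sub
    (hq.const_mul (D * (1 - (n : ℝ) ^ (2 * H))))
  have hlim := hnum.div hq hV.ne'
  rw [show V * D - (n : ℝ) ^ (2 * H) * (V * D) - D * (1 - (n : ℝ) ^ (2 * H)) * V = 0 by ring,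
    zero_div] at hlim
  have hpos : ∀ᶠ m : ℕ in atTop, 0 < (m : ℝ) := tendsto_natCast_atTop_atTop.eventually_gt_atTop 0
  rw [isLittleO_iff_tendsto' (by
    filter_upwards [hpos] with m hm h
    exact absurd h (Real.rpow_pos_of_pos hm _).ne')]
  refine hlim.congr' ?_
  filter_upwards [hpos, hq.eventually (lt_mem_nhds hV)] with m hm hqm
  have hMm := Real.rpow_pos_of_pos hm (2 * H)
  have hωm : ω m ≠ 0 := by
    have : V + (ω m - V * (m : ℝ) ^ (2 * H)) * ((m : ℝ) ^ (2 * H))⁻¹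
        = ω m * ((m : ℝ) ^ (2 * H))⁻¹ := by field_simp; ring
    rw [this] at hqm
    intro h; simp [h] at hqm
  have he : V + (ω m - V * (m : ℝ) ^ (2 * H)) * ((m : ℝ) ^ (2 * H))⁻¹
      = ω m / (m : ℝ) ^ (2 * H) := by field_simp; ring
  rw [Pi.div_apply, he]
  push_cast
  rw [Real.mul_rpow n.cast_nonneg hm.le, Real.rpow_neg hm.le]
  field_simp
  ring

/-! ### The additive constant as a Fourier series -/

section Fourier

variable {g : ℝ → ℝ}

theorem fourierCoeff_even (heven : ∀ x, |x| ≤ 1 / 2 → g (-x) = g x)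
    (hcont : ContinuousOn g (Set.Icc (-(1 / 2) : ℝ) (1 / 2))) (n : ℤ) :
    ∫ x in (-(1 / 2) : ℝ)..(1 / 2), Complex.exp (-(2 * Real.pi * n * x : ℝ) * Complex.I) * (g x : ℂ)
      = ((∫ x in (-(1 / 2) : ℝ)..(1 / 2), g x * Real.cos (2 * Real.pi * n * x) : ℝ) : ℂ) := by
  have hc : ∀ s : ℝ, IntervalIntegrable
      (fun x => Complex.exp ((s * (2 * Real.pi * n * x) : ℝ) * Complex.I) * (g x : ℂ)) volume
      (-(1 / 2) : ℝ) (1 / 2) := by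
    intro s
    refine ContinuousOn.intervalIntegrable ?_
    rw [uIcc_half]
    exact ContinuousOn.mul (by fun_prop) (Complex.continuous_ofReal.comp_continuousOn hcont)
  have hsymm : ∫ x in (-(1 / 2) : ℝ)..(1 / 2),
        Complex.exp (((-1) * (2 * Real.pi * n * x) : ℝ) * Complex.I) * (g x : ℂ)
      = ∫ x in (-(1 / 2) : ℝ)..(1 / 2),
        Complex.exp ((1 * (2 * Real.pi * n * x) : ℝ) * Complex.I) * (g x : ℂ) := by
    have := intervalIntegral.integral_comp_neg (a := (-(1 / 2) : ℝ)) (b := 1 / 2) (fun x =>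
      Complex.exp ((1 * (2 * Real.pi * n * x) : ℝ) * Complex.I) * (g x : ℂ))
    rw [neg_neg] at this
    rw [← this]
    refine intervalIntegral.integral_congr fun x hx => ?_
    rw [uIcc_half] at hx
    rw [heven x (abs_le_half_of_mem hx)]
    congr 4; ring
  have hadd := intervalIntegral.integral_add (hc (-1)) (hc 1)
  rw [← hsymm] at hadd
  have hcos : ∀ x : ℝ, Complex.exp (((-1) * (2 * Real.pi * n * x) : ℝ) * Complex.I) * (g x : ℂ)
      + Complex.exp ((1 * (2 * Real.pi * n * x) : ℝ) * Complex.I) * (g x : ℂ)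
      = ((2 * (g x * Real.cos (2 * Real.pi * n * x)) : ℝ) : ℂ) := by
    intro x
    push_cast
    rw [Complex.cos, neg_one_mul, one_mul]
    ring
  simp_rw [hcos] at hadd
  rw [intervalIntegral.integral_ofReal, intervalIntegral.integral_const_mul, ← two_mul,
    Complex.ofReal_mul, Complex.ofReal_ofNat] at hadd
  rw [mul_left_cancel₀ two_ne_zero hadd]
  refine intervalIntegral.integral_congr fun x _ => ?_
  congr 3
  push_cast; ring

/-- Evenness makes the values at `±1/2` agree, so the periodic lift is continuous, and summable
coefficients give pointwise convergence. Subtracting the series at `0` turns cosines into `sin²`,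
the form that can be integrated against the singular kernel. -/
theorem hasSum_cos_sub_one (heven : ∀ x, |x| ≤ 1 / 2 → g (-x) = g x)
    (hcont : ContinuousOn g (Set.Icc (-(1 / 2) : ℝ) (1 / 2)))
    (hsum : Summable fun j : ℕ =>
      |∫ x in (-(1 / 2) : ℝ)..(1 / 2), g x * Real.cos (2 * Real.pi * j * x)|)
    {x : ℝ} (hx : x ∈ Set.Ico (-(1 / 2) : ℝ) (1 / 2)) :
    HasSum (fun j : ℕ => -4 * (∫ x in (-(1 / 2) : ℝ)..(1 / 2), g x * Real.cos (2 * Real.pi * j * x))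
      * Real.sin (Real.pi * j * x) ^ 2) (g x - g 0) := by
  set c : ℤ → ℝ := fun n => ∫ x in (-(1 / 2) : ℝ)..(1 / 2), g x * Real.cos (2 * Real.pi * n * x)
    with hc
  have hcneg : ∀ n, c (-n) = c n := by
    intro n
    simp only [hc]
    congr 1; ext y
    push_cast
    rw [show 2 * Real.pi * -(n : ℝ) * y = -(2 * Real.pi * n * y) by ring, Real.cos_neg]
  set G : ℝ → ℂ := fun x => (g x : ℂ) with hG
  have hGc : Continuous (AddCircle.liftIco (1 : ℝ) (-(1 / 2)) G) := by
    refine AddCircle.liftIco_continuous ?_ ?_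
    · simp only [hG]
      rw [heven (1 / 2) (by norm_num)]; norm_num
    · rw [show (-(1 / 2) : ℝ) + 1 = 1 / 2 by norm_num]
      exact Complex.continuous_ofReal.comp_continuousOn hcont
  have hcoef : ∀ n : ℤ, fourierCoeff (AddCircle.liftIco (1 : ℝ) (-(1 / 2)) G) n = (c n : ℂ) := by
    intro n
    rw [fourierCoeff_liftIco_eq, fourierCoeffOn_eq_integral]
    simp only [hc]
    rw [← fourierCoeff_even heven hcont n, show (-(1 / 2) : ℝ) + 1 = 1 / 2 by norm_num,
      show (1 / 2 : ℝ) - -(1 / 2) = 1 by norm_num, one_div_one, one_smul]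
    refine intervalIntegral.integral_congr fun y _ => ?_
    simp only [hG]
    rw [fourier_coe_apply, smul_eq_mul]
    congr 2
    push_cast
    ring
  have hsumc : Summable (fourierCoeff (AddCircle.liftIco (1 : ℝ) (-(1 / 2)) G)) := by
    rw [funext hcoef]
    refine Complex.summable_ofReal.2 ?_
    refine Summable.of_nat_of_neg ?_ ?_
    · simpa [hc] using hsum.of_abs
    · simpa [hcneg, hc] using hsum.of_abs
  have hpt : ∀ y ∈ Set.Ico (-(1 / 2) : ℝ) (1 / 2),
      HasSum (fun n : ℤ => c n * Real.cos (2 * Real.pi * n * y)) (g y) := by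
    intro y hy
    have := has_pointwise_sum_fourier_series_of_summable
      (f := ⟨AddCircle.liftIco (1 : ℝ) (-(1 / 2)) G, hGc⟩) hsumc (y : AddCircle (1 : ℝ))
    simp only [ContinuousMap.coe_mk] at this
    rw [AddCircle.liftIco_coe_apply (by rwa [show (-(1 / 2) : ℝ) + 1 = 1 / 2 by norm_num])] at this
    have hre := Complex.hasSum_re this
    simp only [hG, Complex.ofReal_re] at hre
    refine hre.congr_fun fun n => ?_
    rw [hcoef, fourier_coe_apply, smul_eq_mul, Complex.re_ofReal_mul,
      show 2 * (Real.pi : ℂ) * Complex.I * n * y / (1 : ℝ)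
        = ((2 * Real.pi * n * y : ℝ) : ℂ) * Complex.I by push_cast; ring,
      Complex.exp_ofReal_mul_I_re]
  have hdiff := (hpt x hx).sub (hpt 0 ⟨by norm_num, by norm_num⟩)
  -- Folding `n` with `-n` counts `n = 0` twice, but that term is zero.
  have hnat := hdiff.nat_add_neg
  simp only [Int.cast_zero, mul_zero, zero_mul, Real.cos_zero, sub_self, add_zero] at hnat
  refine hnat.congr_fun fun j => ?_
  rw [hcneg]
  simp only [hc]
  push_cast
  rw [Real.sin_sq_eq_half_sub, show 2 * Real.pi * -(j : ℝ) * x = -(2 * Real.pi * j * x) by ring,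
    Real.cos_neg, show 2 * (Real.pi * j * x) = 2 * Real.pi * j * x by ring]
  ring

/-- Each `sin²(πjx)` integrates against the kernel to `I j^{2H}`, which the denominator `2 I` turns
into the stated coefficient; the summability hypothesis is exactly what the exchange of sum and
integral requires. -/
theorem additiveConst_eq_tsum {H : ℝ} (hH : 0 < H) (hH1 : H < 1)
    (heven : ∀ x, |x| ≤ 1 / 2 → g (-x) = g x) (hg0 : g 0 = 1)
    (hcont : ContinuousOn g (Set.Icc (-(1 / 2) : ℝ) (1 / 2)))
    (hsum : Summable fun j : ℕ => (j : ℝ) ^ (2 * H) *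
      |∫ x in (-(1 / 2) : ℝ)..(1 / 2), g x * Real.cos (2 * Real.pi * j * x)|) :
    additiveConst H g = -2 * ∑' j : ℕ, (j : ℝ) ^ (2 * H) *
      ∫ x in (-(1 / 2) : ℝ)..(1 / 2), g x * Real.cos (2 * Real.pi * j * x) := by
  set G : ℕ → ℝ := fun j => ∫ x in (-(1 / 2) : ℝ)..(1 / 2), g x * Real.cos (2 * Real.pi * j * x)
    with hG
  have hI := fgnIntegral_pos hH hH1
  have hsum0 : Summable fun j : ℕ => |G j| := by
    -- The index `0` is set aside: its weight `0^{2H} = 0` does not control `|G 0|`.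
    rw [← summable_nat_add_iff 1]
    refine Summable.of_nonneg_of_le (fun j => abs_nonneg _) (fun j => ?_)
      ((summable_nat_add_iff 1).2 hsum)
    refine le_mul_of_one_le_left (abs_nonneg _) (Real.one_le_rpow ?_ (by linarith))
    push_cast
    linarith [j.cast_nonneg (α := ℝ)]
  have hle : (-(1 / 2) : ℝ) ≤ 1 / 2 := by norm_num
  set F : ℕ → ℝ → ℝ := fun j x =>
    (-4 * G j) * (powKernel H x * Real.sin (Real.pi * j * x) ^ 2) with hF
  have hFi : ∀ j, IntegrableOn (F j) (Set.Ioc (-(1 / 2) : ℝ) (1 / 2)) := fun j =>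
    (intervalIntegrable_iff_integrableOn_Ioc_of_le hle).1
      ((intervalIntegrable_powKernel_mul_sin_sq hH hH1 j).const_mul _)
  have hFint : ∀ j, ∫ x in Set.Ioc (-(1 / 2) : ℝ) (1 / 2), F j x
      = -4 * G j * (fgnIntegral H * (j : ℝ) ^ (2 * H)) := by
    intro j
    rw [← intervalIntegral.integral_of_le hle]
    simp only [hF]
    rw [intervalIntegral.integral_const_mul, integral_powKernel_mul_sin_sq' hH hH1]
  have hZ : ∀ x, 0 ≤ powKernel H x := fun x => tsum_nonneg fun k => by positivity
  have hFn : ∀ j, ∫ x in Set.Ioc (-(1 / 2) : ℝ) (1 / 2), ‖F j x‖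
      = 4 * fgnIntegral H * ((j : ℝ) ^ (2 * H) * |G j|) := by
    intro j
    have : ∀ x, ‖F j x‖ = (4 * |G j|) * (powKernel H x * Real.sin (Real.pi * j * x) ^ 2) := by
      intro x
      rw [norm_mul, Real.norm_of_nonneg (mul_nonneg (hZ x) (sq_nonneg _)), Real.norm_eq_abs,
        abs_mul, abs_neg, Nat.abs_ofNat]
    simp_rw [this]
    rw [← intervalIntegral.integral_of_le hle, intervalIntegral.integral_const_mul,
      integral_powKernel_mul_sin_sq' hH hH1]
    ring
  have hswap := hasSum_integral_of_summable_integral_norm hFi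
    (by simp_rw [hFn]; exact hsum.mul_left _)
  have hlhs : ∫ x in (-(1 / 2) : ℝ)..(1 / 2), powKernel H x * (g x - 1)
      = ∫ x in Set.Ioc (-(1 / 2) : ℝ) (1 / 2), ∑' j, F j x := by
    rw [intervalIntegral.integral_of_le hle]
    have hne : ∀ᵐ x : ℝ, x ≠ 1 / 2 := by simp [ae_iff, measure_singleton]
    refine integral_congr_ae ?_
    filter_upwards [ae_restrict_mem measurableSet_Ioc, ae_restrict_of_ae hne] with x hx hx1
    have := (hasSum_cos_sub_one heven hcont hsum0
      ⟨hx.1.le, lt_of_le_of_ne hx.2 hx1⟩).mul_left (powKernel H x)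
    rw [hg0] at this
    rw [← this.tsum_eq]
    congr 1; ext j
    simp only [hF, hG]; ring
  rw [additiveConst, hlhs, ← hswap.tsum_eq]
  simp_rw [hFint]
  rw [← tsum_mul_left, ← tsum_div_const]
  congr 1; ext j
  change _ = -2 * ((j : ℝ) ^ (2 * H) * G j)
  rw [div_eq_iff (by positivity)]
  ring

end Fourier

/-! ### Decay of the Fourier coefficients of the spectral ratio -/

/-- `f` is twice continuously differentiable on `[0, 1)` with vanishing derivative at `0`, and its
second derivative has a derivative `f₃` on `(0, 1)`, integrable up to `0`. -/
structure HasRegularJet (f f₁ f₂ f₃ : ℝ → ℝ) : Prop where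
  cont₀ : ContinuousOn f (Set.Ico 0 1)
  cont₁ : ContinuousOn f₁ (Set.Ico 0 1)
  cont₂ : ContinuousOn f₂ (Set.Ico 0 1)
  deriv₀ : ∀ x ∈ Set.Ioo (0 : ℝ) 1, HasDerivAt f (f₁ x) x
  deriv₁ : ∀ x ∈ Set.Ioo (0 : ℝ) 1, HasDerivAt f₁ (f₂ x) x
  deriv₂ : ∀ x ∈ Set.Ioo (0 : ℝ) 1, HasDerivAt f₂ (f₃ x) x
  integrable₃ : IntervalIntegrable f₃ volume 0 (1 / 2)
  zero₁ : f₁ 0 = 0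

theorem uIcc_zero_half_subset : Set.uIcc (0 : ℝ) (1 / 2) ⊆ Set.Ico 0 1 := by
  rw [Set.uIcc_of_le (by norm_num)]
  exact fun x hx => ⟨hx.1, by linarith [hx.2]⟩

section Jet

variable {f f₁ f₂ f₃ g g₁ g₂ g₃ : ℝ → ℝ}

/-- Closure under sums, products and reciprocals reduces the spectral ratio to `x^{2H+1}` and smooth
even functions. -/
theorem HasRegularJet.add (hf : HasRegularJet f f₁ f₂ f₃) (hg : HasRegularJet g g₁ g₂ g₃) :
    HasRegularJet (fun x => f x + g x) (fun x => f₁ x + g₁ x) (fun x => f₂ x + g₂ x)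
      (fun x => f₃ x + g₃ x) where
  cont₀ := hf.cont₀.add hg.cont₀
  cont₁ := hf.cont₁.add hg.cont₁
  cont₂ := hf.cont₂.add hg.cont₂
  deriv₀ x hx := (hf.deriv₀ x hx).add (hg.deriv₀ x hx)
  deriv₁ x hx := (hf.deriv₁ x hx).add (hg.deriv₁ x hx)
  deriv₂ x hx := (hf.deriv₂ x hx).add (hg.deriv₂ x hx)
  integrable₃ := hf.integrable₃.add hg.integrable₃
  zero₁ := by rw [hf.zero₁, hg.zero₁, add_zero]

/-- Only the third derivative may blow up at `0`, and in Leibniz' formula it occurs linearly, with a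
continuous factor. -/
theorem HasRegularJet.mul (hf : HasRegularJet f f₁ f₂ f₃) (hg : HasRegularJet g g₁ g₂ g₃) :
    HasRegularJet (fun x => f x * g x) (fun x => f₁ x * g x + f x * g₁ x)
      (fun x => f₂ x * g x + 2 * (f₁ x * g₁ x) + f x * g₂ x)
      (fun x => f₃ x * g x + 3 * (f₂ x * g₁ x + f₁ x * g₂ x) + f x * g₃ x) where
  cont₀ := hf.cont₀.mul hg.cont₀
  cont₁ := (hf.cont₁.mul hg.cont₀).add (hf.cont₀.mul hg.cont₁)
  cont₂ := ((hf.cont₂.mul hg.cont₀).add (continuousOn_const.mul (hf.cont₁.mul hg.cont₁))).add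
    (hf.cont₀.mul hg.cont₂)
  deriv₀ x hx := (hf.deriv₀ x hx).mul (hg.deriv₀ x hx)
  deriv₁ x hx := (((hf.deriv₁ x hx).mul (hg.deriv₀ x hx)).add
    ((hf.deriv₀ x hx).mul (hg.deriv₁ x hx))).congr_deriv (by ring)
  deriv₂ x hx := ((((hf.deriv₂ x hx).mul (hg.deriv₀ x hx)).add
    (((hf.deriv₁ x hx).mul (hg.deriv₁ x hx)).const_mul 2)).add
    ((hf.deriv₀ x hx).mul (hg.deriv₂ x hx))).congr_deriv (by ring)
  integrable₃ := by
    have hs := uIcc_zero_half_subset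
    refine ((hf.integrable₃.mul_continuousOn (hg.cont₀.mono hs)).add
      (ContinuousOn.intervalIntegrable ?_)).add
      (hg.integrable₃.continuousOn_mul (hf.cont₀.mono hs))
    exact (continuousOn_const.mul ((hf.cont₂.mul hg.cont₁).add (hf.cont₁.mul hg.cont₂))).mono hs
  zero₁ := by rw [hf.zero₁, hg.zero₁]; ring

theorem HasRegularJet.inv (hf : HasRegularJet f f₁ f₂ f₃) (h0 : ∀ x ∈ Set.Ico (0 : ℝ) 1, f x ≠ 0) :
    HasRegularJet (fun x => (f x)⁻¹) (fun x => -(f₁ x * (f x)⁻¹ ^ 2))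
      (fun x => -(f₂ x * (f x)⁻¹ ^ 2) + 2 * (f₁ x ^ 2 * (f x)⁻¹ ^ 3))
      (fun x => f₃ x * -((f x)⁻¹ ^ 2)
        + (6 * (f₁ x * f₂ x * (f x)⁻¹ ^ 3) - 6 * (f₁ x ^ 3 * (f x)⁻¹ ^ 4))) := by
  have hi : ContinuousOn (fun x => (f x)⁻¹) (Set.Ico 0 1) := hf.cont₀.inv₀ h0
  have hid : ∀ x ∈ Set.Ioo (0 : ℝ) 1,
      HasDerivAt (fun x => (f x)⁻¹) (-(f₁ x * (f x)⁻¹ ^ 2)) x := fun x hx =>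
    ((hf.deriv₀ x hx).fun_inv (h0 x (Set.Ioo_subset_Ico_self hx))).congr_deriv (by
      rw [inv_pow]; ring)
  have hpow : ∀ (n : ℕ), ∀ x ∈ Set.Ioo (0 : ℝ) 1, HasDerivAt (fun x => (f x)⁻¹ ^ n)
      (n * (f x)⁻¹ ^ (n - 1) * (-(f₁ x * (f x)⁻¹ ^ 2))) x := fun n x hx => (hid x hx).fun_pow n
  have hs := uIcc_zero_half_subset
  exact {
    cont₀ := hi
    cont₁ := (hf.cont₁.mul (hi.pow 2)).neg
    cont₂ := (hf.cont₂.mul (hi.pow 2)).neg.add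
      (continuousOn_const.mul ((hf.cont₁.pow 2).mul (hi.pow 3)))
    deriv₀ := hid
    deriv₁ := fun x hx => (((hf.deriv₁ x hx).mul (hpow 2 x hx)).neg).congr_deriv (by
      push_cast; ring)
    deriv₂ := fun x hx => ((((hf.deriv₂ x hx).mul (hpow 2 x hx)).neg).add
      ((((hf.deriv₁ x hx).fun_pow 2).mul (hpow 3 x hx)).const_mul 2)).congr_deriv (by
        push_cast; ring)
    integrable₃ := (hf.integrable₃.mul_continuousOn ((hi.pow 2).neg.mono hs)).add
      (((continuousOn_const.mul ((hf.cont₁.mul hf.cont₂).mul (hi.pow 3))).sub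
        (continuousOn_const.mul ((hf.cont₁.pow 3).mul (hi.pow 4)))).mono hs).intervalIntegrable
    zero₁ := by rw [hf.zero₁]; simp }

/-- The condition `2 < a` is what makes `x^{a-3}` integrable at `0`; for `a = 2H + 1` it means `H >
1/2`. -/
theorem hasRegularJet_rpow {a : ℝ} (ha : 2 < a) :
    HasRegularJet (fun x => x ^ a) (fun x => a * x ^ (a - 1)) (fun x => a * (a - 1) * x ^ (a - 2))
      (fun x => a * (a - 1) * (a - 2) * x ^ (a - 3)) where
  cont₀ := (Real.continuous_rpow_const (by linarith)).continuousOn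
  cont₁ := (continuous_const.mul (Real.continuous_rpow_const (by linarith))).continuousOn
  cont₂ := (continuous_const.mul (Real.continuous_rpow_const (by linarith))).continuousOn
  deriv₀ x hx := Real.hasDerivAt_rpow_const (Or.inl hx.1.ne')
  deriv₁ x hx := ((Real.hasDerivAt_rpow_const (p := a - 1) (Or.inl hx.1.ne')).const_mul
    a).congr_deriv (by rw [show a - 1 - 1 = a - 2 by ring]; ring)
  deriv₂ x hx := ((Real.hasDerivAt_rpow_const (p := a - 2) (Or.inl hx.1.ne')).const_mul
    (a * (a - 1))).congr_deriv (by rw [show a - 2 - 1 = a - 3 by ring]; ring)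
  integrable₃ := (intervalIntegral.intervalIntegrable_rpow' (by linarith)).const_mul _
  zero₁ := by rw [Real.zero_rpow (by linarith), mul_zero]

theorem hasRegularJet_of_contDiffOn {φ : ℝ → ℝ} (hφ : ContDiffOn ℝ 3 φ (Set.Ioo (-1) 1))
    (heven : ∀ x, φ (-x) = φ x) :
    HasRegularJet φ (deriv φ) (deriv (deriv φ)) (deriv (deriv (deriv φ))) := by
  have h1 := (contDiffOn_succ_iff_deriv_of_isOpen (n := 2) isOpen_Ioo).1 hφ
  have h2 := (contDiffOn_succ_iff_deriv_of_isOpen (n := 1) isOpen_Ioo).1 h1.2.2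
  have h3 := (contDiffOn_succ_iff_deriv_of_isOpen (n := 0) isOpen_Ioo).1 h2.2.2
  have hs : Set.Ico (0 : ℝ) 1 ⊆ Set.Ioo (-1) 1 := fun x hx => ⟨by linarith [hx.1], hx.2⟩
  have hs' := Set.Ioo_subset_Ico_self.trans hs
  have hd : ∀ {ψ : ℝ → ℝ}, DifferentiableOn ℝ ψ (Set.Ioo (-1) 1) →
      ∀ x ∈ Set.Ioo (0 : ℝ) 1, HasDerivAt ψ (deriv ψ x) x := fun hψ x hx =>
    ((hψ x (hs' hx)).differentiableAt (isOpen_Ioo.mem_nhds (hs' hx))).hasDerivAt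
  exact {
    cont₀ := h1.1.continuousOn.mono hs
    cont₁ := h2.1.continuousOn.mono hs
    cont₂ := h3.1.continuousOn.mono hs
    deriv₀ := hd h1.1
    deriv₁ := hd h2.1
    deriv₂ := hd h3.1
    integrable₃ := (h3.2.2.continuousOn.mono (uIcc_zero_half_subset.trans hs)).intervalIntegrable
    zero₁ := by
      have := deriv_comp_neg (f := φ) (x := (0 : ℝ))
      rw [funext heven, neg_zero] at this
      linarith }

theorem integral_mul_cos_eq {u u' : ℝ → ℝ} (hu : ContinuousOn u (Set.Ico 0 1))
    (hd : ∀ x ∈ Set.Ioo (0 : ℝ) 1, HasDerivAt u (u' x) x)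
    (hi : IntervalIntegrable u' volume 0 (1 / 2)) {j : ℕ} (hj : 1 ≤ j) :
    ∫ x in (0 : ℝ)..(1 / 2), u x * Real.cos (2 * Real.pi * j * x)
      = -(2 * Real.pi * j)⁻¹ * ∫ x in (0 : ℝ)..(1 / 2), u' x * Real.sin (2 * Real.pi * j * x) := by
  have hj0 : (0 : ℝ) < j := by exact_mod_cast hj
  have hw : 2 * Real.pi * j ≠ 0 := by positivity
  have := intervalIntegral.integral_mul_deriv_eq_deriv_mul_of_hasDerivAt (a := 0) (b := 1 / 2)
    (u := u) (u' := u') (v := fun x => (2 * Real.pi * j)⁻¹ * Real.sin (2 * Real.pi * j * x))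
    (v' := fun x => Real.cos (2 * Real.pi * j * x)) (hu.mono uIcc_zero_half_subset)
    (by fun_prop)
    (fun x hx => hd x (by
      rw [min_eq_left (by norm_num), max_eq_right (by norm_num)] at hx
      exact ⟨hx.1, by linarith [hx.2]⟩))
    (fun x _ => by
      have h1 : HasDerivAt (fun x : ℝ => 2 * Real.pi * j * x) (2 * Real.pi * j) x := by
        simpa using (hasDerivAt_id x).const_mul (2 * Real.pi * j)
      refine (h1.sin.const_mul (2 * Real.pi * j)⁻¹).congr_deriv ?_
      field_simp)
    hi (Continuous.intervalIntegrable (by fun_prop) _ _)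
  rw [this, show 2 * Real.pi * j * (1 / 2) = j * Real.pi by ring, Real.sin_nat_mul_pi]
  simp only [mul_zero, Real.sin_zero, sub_zero, zero_sub, neg_mul]
  rw [← intervalIntegral.integral_const_mul]
  refine congrArg Neg.neg (intervalIntegral.integral_congr fun x _ => ?_)
  ring

theorem integral_mul_sin_eq {u u' : ℝ → ℝ} (hu : ContinuousOn u (Set.Ico 0 1))
    (hd : ∀ x ∈ Set.Ioo (0 : ℝ) 1, HasDerivAt u (u' x) x)
    (hi : IntervalIntegrable u' volume 0 (1 / 2)) (h0 : u 0 = 0) (h1 : u (1 / 2) = 0) {j : ℕ}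
    (hj : 1 ≤ j) :
    ∫ x in (0 : ℝ)..(1 / 2), u x * Real.sin (2 * Real.pi * j * x)
      = (2 * Real.pi * j)⁻¹ * ∫ x in (0 : ℝ)..(1 / 2), u' x * Real.cos (2 * Real.pi * j * x) := by
  have hj0 : (0 : ℝ) < j := by exact_mod_cast hj
  have hw : 2 * Real.pi * j ≠ 0 := by positivity
  have := intervalIntegral.integral_mul_deriv_eq_deriv_mul_of_hasDerivAt (a := 0) (b := 1 / 2)
    (u := u) (u' := u') (v := fun x => -(2 * Real.pi * j)⁻¹ * Real.cos (2 * Real.pi * j * x))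
    (v' := fun x => Real.sin (2 * Real.pi * j * x)) (hu.mono uIcc_zero_half_subset)
    (by fun_prop)
    (fun x hx => hd x (by
      rw [min_eq_left (by norm_num), max_eq_right (by norm_num)] at hx
      exact ⟨hx.1, by linarith [hx.2]⟩))
    (fun x _ => by
      have h1 : HasDerivAt (fun x : ℝ => 2 * Real.pi * j * x) (2 * Real.pi * j) x := by
        simpa using (hasDerivAt_id x).const_mul (2 * Real.pi * j)
      refine (h1.cos.const_mul (-(2 * Real.pi * j)⁻¹)).congr_deriv ?_
      field_simp)
    hi (Continuous.intervalIntegrable (by fun_prop) _ _)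
  rw [this, h0, h1, zero_mul, zero_mul, sub_zero, zero_sub, ← intervalIntegral.integral_neg,
    ← intervalIntegral.integral_const_mul]
  congr 1; ext x; ring

/-- Three integrations by parts. In the first and third the boundary terms vanish because
`sin(2πjx)` does at `0` and `1/2`; in the second because `f₁` does. -/
theorem HasRegularJet.exists_integral_mul_cos_le (hf : HasRegularJet f f₁ f₂ f₃)
    (h1 : f₁ (1 / 2) = 0) : ∃ C, ∀ j : ℕ, 1 ≤ j →
      |∫ x in (0 : ℝ)..(1 / 2), f x * Real.cos (2 * Real.pi * j * x)| ≤ C * ((j : ℝ) ^ 3)⁻¹ := by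
  refine ⟨∫ x in (0 : ℝ)..(1 / 2), |f₃ x|, fun j hj => ?_⟩
  have hj0 : (0 : ℝ) < j := by exact_mod_cast hj
  have hs := uIcc_zero_half_subset
  rw [integral_mul_cos_eq hf.cont₀ hf.deriv₀ (hf.cont₁.mono hs).intervalIntegrable hj,
    integral_mul_sin_eq hf.cont₁ hf.deriv₁ (hf.cont₂.mono hs).intervalIntegrable hf.zero₁ h1 hj,
    integral_mul_cos_eq hf.cont₂ hf.deriv₂ hf.integrable₃ hj, abs_mul, abs_mul, abs_mul, abs_neg,
    abs_of_pos (show 0 < (2 * Real.pi * j)⁻¹ by positivity)]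
  have hb : |∫ x in (0 : ℝ)..(1 / 2), f₃ x * Real.sin (2 * Real.pi * j * x)|
      ≤ ∫ x in (0 : ℝ)..(1 / 2), |f₃ x| := by
    refine (intervalIntegral.abs_integral_le_integral_abs (by norm_num)).trans ?_
    refine intervalIntegral.integral_mono_on (by norm_num)
      (hf.integrable₃.mul_continuousOn (by fun_prop)).abs hf.integrable₃.abs fun x _ => ?_
    rw [abs_mul]
    exact mul_le_of_le_one_right (abs_nonneg _) (Real.abs_sin_le_one _)
  have hw : (2 * Real.pi * j)⁻¹ ≤ (j : ℝ)⁻¹ := by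
    refine inv_anti₀ hj0 ?_
    nlinarith [Real.pi_gt_three]
  have hnn : 0 ≤ ∫ x in (0 : ℝ)..(1 / 2), |f₃ x| :=
    intervalIntegral.integral_nonneg (by norm_num) fun x _ => abs_nonneg _
  calc _ ≤ (j : ℝ)⁻¹ * ((j : ℝ)⁻¹ * ((j : ℝ)⁻¹ * ∫ x in (0 : ℝ)..(1 / 2), |f₃ x|)) := by
        gcongr
    _ = _ := by field_simp

end Jet

/-- Reindex by `k ↦ -1 - k`. -/
theorem powKernel_one_sub (H x : ℝ) : powKernel H (1 - x) = powKernel H x := by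
  unfold powKernel
  rw [← (Equiv.subLeft (-1 : ℤ)).tsum_eq]
  congr 1; ext k
  rw [Equiv.subLeft_apply, ← abs_neg]
  push_cast
  congr 2; ring

/-- The right side is visibly symmetric under `x ↦ 1 - x`, which the factored form on the left
hides. -/
theorem sincWeight_mul_inv_eq {H : ℝ} (hH : 0 < H) {x : ℝ} (hx0 : 0 < x) (hx1 : x < 1) :
    sincWeight H x * (1 + x ^ (2 * H + 1) * regKernel H x)⁻¹
      = Real.pi ^ (2 * H + 1) * Real.sin (Real.pi * x) ^ (-(2 * H + 1)) * (powKernel H x)⁻¹ := by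
  have hx : |x| < 1 := by rwa [abs_of_pos hx0]
  have hpi := Real.pi_pos
  have hs : 0 < Real.sin (Real.pi * x) :=
    Real.sin_pos_of_pos_of_lt_pi (by positivity) (by nlinarith)
  have hR := one_add_regKernel_pos H hx
  rw [powKernel_eq_mul hH hx hx0.ne', sincWeight, Real.sinc_of_ne_zero (by positivity),
    Real.div_rpow hs.le (by positivity), Real.mul_rpow hpi.le hx0.le, abs_of_pos hx0,
    Real.rpow_neg hpi.le]
  rw [abs_of_pos hx0] at hR
  have p1 := (Real.rpow_pos_of_pos hpi (2 * H + 1)).ne'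
  have p2 := (Real.rpow_pos_of_pos hx0 (-(2 * H + 1))).ne'
  field_simp

section Decay

variable {H : ℝ} {h : ℝ → ℝ}

theorem summable_ratioCoeff (hH : 1 / 2 < H) (hH1 : H < 1) (h0 : 0 < h 0)
    (hcont : ContinuousOn h (Set.Icc (-(1 / 2) : ℝ) (1 / 2))) (heven : ∀ x, h (-x) = h x)
    {p : ℝ → ℝ} (hp : Function.Periodic p 1) (hp3 : ContDiff ℝ 3 p) (hpe : ∀ x, p (-x) = p x)
    (hph : Set.EqOn p h (Set.Icc (-(1 / 2) : ℝ) (1 / 2))) :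
    Summable fun j : ℕ => (j : ℝ) ^ (2 * H) * |ratioCoeff H h j| := by
  have hH0 : 0 < H := by linarith
  have hU := hasRegularJet_of_contDiffOn (φ := fun x => p x / h 0 * sincWeight H x)
    ((hp3.contDiffOn.div_const _).mul (contDiffOn_sincWeight H))
    (fun x => by rw [hpe, sincWeight_neg])
  have hone := hasRegularJet_of_contDiffOn (φ := fun _ => 1) contDiffOn_const (fun _ => rfl)
  have hN := hone.add ((hasRegularJet_rpow (show 2 < 2 * H + 1 by linarith)).mul
    (hasRegularJet_of_contDiffOn (contDiffOn_regKernel 3 hH0) (regKernel_neg H)))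
  have hNpos : ∀ x ∈ Set.Ico (0 : ℝ) 1, 1 + x ^ (2 * H + 1) * regKernel H x ≠ 0 := by
    intro x hx
    have := one_add_regKernel_pos H (show |x| < 1 by rw [abs_of_nonneg hx.1]; exact hx.2)
    rw [abs_of_nonneg hx.1] at this
    exact this.ne'
  have hg := hU.mul (hN.inv hNpos)
  -- With `p` in place of `h` the ratio lives on both sides of `1/2`, where its symmetry forces the
  -- derivative to vanish. On `[0, 1/2]` it is the spectral ratio.
  set g : ℝ → ℝ := fun x => p x / h 0 * sincWeight H x * (1 + x ^ (2 * H + 1) * regKernel H x)⁻¹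
    with hgdef
  have hsymm : ∀ x ∈ Set.Ioo (0 : ℝ) 1, g (1 - x) = g x := by
    intro x hx
    simp only [hgdef]
    rw [mul_assoc, mul_assoc, sincWeight_mul_inv_eq hH0 hx.1 hx.2,
      sincWeight_mul_inv_eq hH0 (by linarith [hx.2]) (by linarith [hx.1]), powKernel_one_sub,
      show Real.pi * (1 - x) = Real.pi - Real.pi * x by ring, Real.sin_pi_sub,
      show 1 - x = -x + 1 by ring, hp, hpe]
  have hhalf : (1 / 2 : ℝ) ∈ Set.Ioo (0 : ℝ) 1 := ⟨by norm_num, by norm_num⟩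
  obtain ⟨C, hC⟩ := hg.exists_integral_mul_cos_le (by
    have h1 := hg.deriv₀ _ hhalf
    have h2 : HasDerivAt (fun x : ℝ => 1 - x) (-1) (1 / 2) := by
      simpa using (hasDerivAt_id (1 / 2 : ℝ)).const_sub 1
    have h3 := HasDerivAt.comp (h₂ := g) (1 / 2 : ℝ)
      (by rw [show (1 : ℝ) - 1 / 2 = 1 / 2 by norm_num]; exact h1) h2
    have h4 := h3.congr_of_eventuallyEq (f₁ := g) (by
      filter_upwards [isOpen_Ioo.mem_nhds hhalf] with x hx
      exact (hsymm x hx).symm)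
    have := h4.unique h1
    linarith)
  have hcoef : ∀ j : ℕ, 1 ≤ j → |ratioCoeff H h j| ≤ 2 * C * ((j : ℝ) ^ 3)⁻¹ := by
    intro j hj
    have hci := continuousOn_spectralRatio hH0 h0 hcont
    have hc : ContinuousOn (fun x => spectralRatio H h x * Real.cos (2 * Real.pi * (j : ℝ) * x))
      (Set.Icc (-(1 / 2) : ℝ) (1 / 2)) := hci.mul (by fun_prop)
    have i1 : IntervalIntegrable
        (fun x => spectralRatio H h x * Real.cos (2 * Real.pi * (j : ℝ) * x)) volume
        (-(1 / 2) : ℝ) 0 := ContinuousOn.intervalIntegrable (hc.mono (by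
          rw [Set.uIcc_of_le (by norm_num)]; exact Set.Icc_subset_Icc_right (by norm_num)))
    have i2 : IntervalIntegrable
        (fun x => spectralRatio H h x * Real.cos (2 * Real.pi * (j : ℝ) * x)) volume
        0 (1 / 2 : ℝ) := ContinuousOn.intervalIntegrable (hc.mono (by
          rw [Set.uIcc_of_le (by norm_num)]; exact Set.Icc_subset_Icc_left (by norm_num)))
    have e1 : ∫ x in (-(1 / 2) : ℝ)..0,
          spectralRatio H h x * Real.cos (2 * Real.pi * (j : ℝ) * x)
        = ∫ x in (0 : ℝ)..(1 / 2), spectralRatio H h x * Real.cos (2 * Real.pi * (j : ℝ) * x) := by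
      rw [← neg_zero, ← intervalIntegral.integral_comp_neg, neg_zero]
      refine intervalIntegral.integral_congr fun x hx => ?_
      rw [Set.uIcc_of_le (by norm_num)] at hx
      rw [spectralRatio_neg heven hH0 h0 (abs_le.2 ⟨by linarith [hx.1], hx.2⟩), mul_neg,
        Real.cos_neg]
    have e2 : ∫ x in (0 : ℝ)..(1 / 2), spectralRatio H h x * Real.cos (2 * Real.pi * (j : ℝ) * x)
        = ∫ x in (0 : ℝ)..(1 / 2), g x * Real.cos (2 * Real.pi * (j : ℝ) * x) := by
      refine intervalIntegral.integral_congr fun x hx => ?_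
      rw [Set.uIcc_of_le (by norm_num)] at hx
      have hx' : x ∈ Set.Icc (-(1 / 2) : ℝ) (1 / 2) := ⟨by linarith [hx.1], hx.2⟩
      simp only [hgdef]
      rw [spectralRatio_eq hH0 h0 (abs_le.2 hx'), hph hx', abs_of_nonneg hx.1]
    rw [ratioCoeff, ← intervalIntegral.integral_add_adjacent_intervals i1 i2, e1, e2, ← two_mul,
      abs_mul, abs_two, mul_assoc 2 C]
    exact mul_le_mul_of_nonneg_left (hC j hj) zero_le_two
  rw [← summable_nat_add_iff 1]
  have hs := (summable_nat_add_iff 1).2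
    ((Real.summable_nat_rpow.2 (show 2 * H - 3 < -1 by linarith)).mul_left (2 * C))
  refine Summable.of_nonneg_of_le (fun j => by positivity) (fun j => ?_) hs
  have hj : (0 : ℝ) < ((j + 1 : ℕ) : ℝ) := by positivity
  calc _ ≤ ((j + 1 : ℕ) : ℝ) ^ (2 * H) * (2 * C * (((j + 1 : ℕ) : ℝ) ^ 3)⁻¹) := by
        gcongr; exact hcoef _ (by omega)
    _ = _ := by
        rw [Real.rpow_sub hj, show (3 : ℝ) = ((3 : ℕ) : ℝ) by norm_num, Real.rpow_natCast]
        ring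

end Decay

/-! ### Reduction to an even spectral density -/

/-- The even part of a function. -/
noncomputable def evenPart (q : ℝ → ℝ) (x : ℝ) : ℝ := (q x + q (-x)) / 2

theorem evenPart_neg (q : ℝ → ℝ) (x : ℝ) : evenPart q (-x) = evenPart q x := by
  unfold evenPart; rw [neg_neg, add_comm]

theorem evenPart_zero (q : ℝ → ℝ) : evenPart q 0 = q 0 := by
  unfold evenPart; rw [neg_zero]; ring

/-- An even weight sees only the even part. The Fejér kernel and the cosines are such weights, so
variances and the `G_j` are unchanged when `h` is symmetrised. -/
theorem integral_evenPart_mul {q e : ℝ → ℝ} (he : ∀ x, e (-x) = e x)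
    (hi : IntervalIntegrable (fun x => q x * e x) volume (-(1 / 2) : ℝ) (1 / 2)) :
    ∫ x in (-(1 / 2) : ℝ)..(1 / 2), evenPart q x * e x
      = ∫ x in (-(1 / 2) : ℝ)..(1 / 2), q x * e x := by
  have hi' : IntervalIntegrable (fun x => q (-x) * e (-x)) volume (-(1 / 2) : ℝ) (1 / 2) := by
    have := (IntervalIntegrable.iff_comp_neg).1 hi.symm
    simpa using this
  have h1 := intervalIntegral.integral_comp_neg (a := (-(1 / 2) : ℝ)) (b := 1 / 2)
    (fun x => q x * e x)
  rw [neg_neg] at h1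
  have h2 := intervalIntegral.integral_add hi hi'
  rw [h1, ← two_mul] at h2
  have h3 : ∫ x in (-(1 / 2) : ℝ)..(1 / 2), evenPart q x * e x
      = 1 / 2 * ∫ x in (-(1 / 2) : ℝ)..(1 / 2), (q x * e x + q (-x) * e (-x)) := by
    rw [← intervalIntegral.integral_const_mul]
    congr 1; ext x
    rw [he, evenPart]; ring
  rw [h3, h2]; ring

theorem ContinuousOn.evenPart {q : ℝ → ℝ} (hq : ContinuousOn q (Set.Icc (-(1 / 2) : ℝ) (1 / 2))) :
    ContinuousOn (evenPart q) (Set.Icc (-(1 / 2) : ℝ) (1 / 2)) := by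
  refine (hq.add (hq.comp continuousOn_neg fun x hx => ?_)).div_const 2
  exact ⟨by linarith [hx.2], by linarith [hx.1]⟩

theorem ContDiffOn.evenPart {q : ℝ → ℝ} {n : WithTop ℕ∞}
    (hq : ContDiffOn ℝ n q (Set.Ioo (-(1 / 2) : ℝ) (1 / 2))) :
    ContDiffOn ℝ n (evenPart q) (Set.Ioo (-(1 / 2) : ℝ) (1 / 2)) := by
  refine (hq.add (hq.comp contDiff_neg.contDiffOn fun x hx => ?_)).div_const 2
  exact ⟨by linarith [hx.2], by linarith [hx.1]⟩

section EvenPart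

variable {H : ℝ} {h : ℝ → ℝ}

theorem fracPrefactor_evenPart : fracPrefactor H (evenPart h) = fracPrefactor H h := by
  unfold fracPrefactor; rw [evenPart_zero]

theorem fracSpectralDensity_evenPart (x : ℝ) :
    fracSpectralDensity H (evenPart h) x = evenPart (fracSpectralDensity H h) x := by
  simp only [fracSpectralDensity, evenPart]
  rw [mul_neg, Real.sin_neg, mul_neg, abs_neg]; ring

theorem fejerIntegral_evenPart (hH : 1 / 2 < H) (hH1 : H < 1)
    (hcont : ContinuousOn h (Set.Icc (-(1 / 2) : ℝ) (1 / 2))) (n : ℕ) :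
    fejerIntegral (fracSpectralDensity H (evenPart h)) n
      = fejerIntegral (fracSpectralDensity H h) n := by
  unfold fejerIntegral
  simp_rw [fracSpectralDensity_evenPart]
  refine integral_evenPart_mul (e := fun x => Real.sin (Real.pi * n * x) ^ 2
    / Real.sin (Real.pi * x) ^ 2) (fun x => by simp) ?_
  -- The quotient of squared sines is a trigonometric polynomial off the origin, by Fejér's
  -- identity, so multiplying by it preserves integrability.
  have hi := (intervalIntegrable_fracSpectralDensity hH hH1 hcont).mul_continuousOn
    (g := fun x => doubleSum (fun k => Real.cos (2 * (Real.pi * x) * k)) n)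
    (by unfold doubleSum; fun_prop)
  refine hi.congr_ae ?_
  filter_upwards [ae_restrict_mem measurableSet_uIoc, ae_restrict_of_ae ae_ne_zero] with x hx hx0
  have hs := sin_pi_mul_ne_zero (abs_le_half_of_mem (mem_Icc_of_mem_uIoc hx)) hx0
  have := doubleSum_cos_mul_sin_sq n (Real.pi * x)
  rw [show Real.pi * n * x = n * (Real.pi * x) by ring, ← this,
    mul_div_cancel_right₀ _ (pow_ne_zero 2 hs)]

theorem spectralRatio_evenPart (hH : 0 < H) (h0 : 0 < h 0) {x : ℝ} (hx : |x| ≤ 1 / 2) :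
    spectralRatio H (evenPart h) x = evenPart (spectralRatio H h) x := by
  rw [spectralRatio_eq hH (by rwa [evenPart_zero]) hx, evenPart_zero]
  unfold evenPart
  rw [spectralRatio_eq hH h0 hx, spectralRatio_eq hH h0 (by rwa [abs_neg]), sincWeight_neg,
    regKernel_neg, abs_neg]
  ring

theorem ratioCoeff_evenPart (hH : 0 < H) (h0 : 0 < h 0)
    (hcont : ContinuousOn h (Set.Icc (-(1 / 2) : ℝ) (1 / 2))) (j : ℕ) :
    ratioCoeff H (evenPart h) j = ratioCoeff H h j := by
  unfold ratioCoeff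
  rw [← integral_evenPart_mul (q := spectralRatio H h)
    (e := fun x => Real.cos (2 * Real.pi * (j : ℝ) * x)) (fun x => by simp)]
  · refine intervalIntegral.integral_congr fun x hx => ?_
    rw [uIcc_half] at hx
    rw [spectralRatio_evenPart hH h0 (abs_le_half_of_mem hx)]
  · refine ContinuousOn.intervalIntegrable ?_
    rw [uIcc_half]
    exact (continuousOn_spectralRatio hH h0 hcont).mul (by fun_prop)

end EvenPart

end FracDiff

/-! ### Assembly of the theorem. -/

theorem mainTheorem3 {Ω : Type*} [MeasurableSpace Ω] (μ : Measure Ω) [IsProbabilityMeasure μ]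
    (H : ℝ) (hH : 1 / 2 < H) (hH1 : H < 1)
    (h : ℝ → ℝ) (hpos : ∀ x ∈ Set.Icc (-(1 / 2) : ℝ) (1 / 2), 0 < h x)
    (hcont : ContinuousOn h (Set.Icc (-(1 / 2) : ℝ) (1 / 2)))
    (hdiff : ContDiffOn ℝ 3 h (Set.Ioo (-(1 / 2) : ℝ) (1 / 2)))
    (X Y : ℤ → Ω → ℝ)
    (hY : FracDiff.IsSecondOrderStationary μ Y)
    (hYh : FracDiff.HasSpectralDensity μ Y h)
    (hX : FracDiff.IsFracDiff μ (-(H - 1 / 2)) Y X) :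
    ∃ D : ℝ,
      -- speed of convergence of the CTF under aggregation
      (∀ n : ℕ, 1 ≤ n →
        (fun m : ℕ => FracDiff.ctf μ (FracDiff.aggregate X m) n -
            (FracDiff.fgnCTF H n + D * (1 - (n : ℝ) ^ (2 * H)) * (m : ℝ) ^ (-(2 * H))))
          =o[atTop] (fun m : ℕ => (m : ℝ) ^ (-(2 * H))) ∧
        (fun m : ℕ => FracDiff.ctf μ (FracDiff.aggregate X m) n - FracDiff.fgnCTF H n)
          =O[atTop] (fun m : ℕ => (m : ℝ) ^ (-(2 * H)))) ∧
      -- `D` is the additive constant, relative to `V`, between the VTF and that of its fGn limit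
      Tendsto (fun n : ℕ => FracDiff.vtf μ X n -
          FracDiff.fgnVTF H (FracDiff.fgnVariance H (FracDiff.fracPrefactor H h)) n)
        atTop (𝓝 (FracDiff.fgnVariance H (FracDiff.fracPrefactor H h) * D)) ∧
      -- `D = -2 ∑_{j ≥ 1} j^{2H} G_j` whenever the series converges absolutely
      ((Summable fun j : ℕ => (j : ℝ) ^ (2 * H) * |FracDiff.ratioCoeff H h j|) →
        D = -2 * ∑' j : ℕ, (j : ℝ) ^ (2 * H) * FracDiff.ratioCoeff H h j) ∧
      -- it does so as soon as the periodic extension of `h` is `C³`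
      ((∃ p : ℝ → ℝ, Function.Periodic p 1 ∧ ContDiff ℝ 3 p ∧
          Set.EqOn p h (Set.Icc (-(1 / 2) : ℝ) (1 / 2))) →
        Summable fun j : ℕ => (j : ℝ) ^ (2 * H) * |FracDiff.ratioCoeff H h j|) := by
  have hH0 : 0 < H := by linarith
  have h0 : 0 < h 0 := hpos 0 ⟨by norm_num, by norm_num⟩
  have hcov := FracDiff.covariance_fracDiff hH hH1 hcont hY.memLp hYh hX
  have hf := FracDiff.intervalIntegrable_fracSpectralDensity hH hH1 hcont
  -- The values of `h` outside the interval are arbitrary, while the regularity lemmas use evenness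
  -- on all of `ℝ`; the even part supplies it without changing `h 0`, the variances or the `G_j`.
  set e := FracDiff.evenPart h with he
  have he0 : 0 < e 0 := by rw [he, FracDiff.evenPart_zero]; exact h0
  have hec : ContinuousOn e (Set.Icc (-(1 / 2) : ℝ) (1 / 2)) := FracDiff.ContinuousOn.evenPart hcont
  have hed : ContDiffOn ℝ 2 e (Set.Ioo (-(1 / 2) : ℝ) (1 / 2)) :=
    FracDiff.ContDiffOn.evenPart (hdiff.of_le (by norm_num))
  have hee : ∀ x, e (-x) = e x := FracDiff.evenPart_neg h
  have hrc := FracDiff.continuousOn_spectralRatio hH0 he0 hec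
  obtain ⟨C, hC⟩ := FracDiff.exists_spectralRatio_sub_one_le hH he0 hec hed hee
  have hV : 0 < FracDiff.fgnVariance H (FracDiff.fracPrefactor H h) := by
    rw [FracDiff.fgnVariance_eq hH0 hH1]
    have := FracDiff.fracPrefactor_pos (H := H) h0
    have := FracDiff.fgnIntegral_pos hH0 hH1
    positivity
  have hcoef : ∀ j, FracDiff.ratioCoeff H h j = FracDiff.ratioCoeff H e j := fun j =>
    (FracDiff.ratioCoeff_evenPart hH0 h0 hcont j).symm
  set D := FracDiff.additiveConst H (FracDiff.spectralRatio H e)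
  have hω := FracDiff.tendsto_fejerIntegral_sub hH0 hH1 he0 hrc hC
  simp_rw [he, FracDiff.fejerIntegral_evenPart hH hH1 hcont, FracDiff.fracPrefactor_evenPart,
    ← he] at hω
  refine ⟨D, fun n hn => ?_, ?_, fun hs => ?_, ?_⟩
  · have hlo : (fun m : ℕ => FracDiff.ctf μ (FracDiff.aggregate X m) n -
        (FracDiff.fgnCTF H n + D * (1 - (n : ℝ) ^ (2 * H)) * (m : ℝ) ^ (-(2 * H))))
        =o[atTop] (fun m : ℕ => (m : ℝ) ^ (-(2 * H))) := by
      refine (FracDiff.aggregation_asymptotics hV hH0 hω hn).congr' ?_ EventuallyEq.rfl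
      filter_upwards [eventually_ge_atTop 1] with m hm
      rw [FracDiff.ctf_aggregate hf hX.memLp hcov hm, FracDiff.fgnCTF]
    refine ⟨hlo, ?_⟩
    have hO : (fun m : ℕ => D * (1 - (n : ℝ) ^ (2 * H)) * (m : ℝ) ^ (-(2 * H)))
        =O[atTop] (fun m : ℕ => (m : ℝ) ^ (-(2 * H))) := isBigO_const_mul_self _ _ _
    refine (hlo.isBigO.add hO).congr_left fun m => ?_
    ring
  · simp_rw [FracDiff.vtf_eq_fejerIntegral hf hX.memLp hcov]
    exact hω
  -- The series starts at `j = 0`, whose term vanishes because `0^{2H} = 0`.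
  · simp_rw [hcoef] at hs ⊢
    exact FracDiff.additiveConst_eq_tsum hH0 hH1
      (fun x hx => FracDiff.spectralRatio_neg hee hH0 he0 hx) (by simp [FracDiff.spectralRatio])
      hrc hs
  · rintro ⟨p, hp, hp3, hph⟩
    simp_rw [hcoef]
    refine FracDiff.summable_ratioCoeff hH hH1 he0 hec hee (p := FracDiff.evenPart p) ?_ ?_
      (FracDiff.evenPart_neg p) ?_
    · intro x
      rw [FracDiff.evenPart, FracDiff.evenPart, hp, neg_add, ← sub_eq_add_neg, hp.sub_eq]
    · exact (hp3.add (hp3.comp contDiff_neg)).div_const 2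
    · intro x hx
      have hx' : -x ∈ Set.Icc (-(1 / 2) : ℝ) (1 / 2) := ⟨by linarith [hx.2], by linarith [hx.1]⟩
      rw [he, FracDiff.evenPart, FracDiff.evenPart, hph hx, hph hx']
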